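/- All graphs are finite and simple, $\kappa$ is a positive integer and $[\kappa]=\{1,\dots,\kappa\}$. A *cover* of a graph $G$ is a graph $H$ on $\bigcup_{v\in V(G)}X_v$, $X_v=\{v\}\times[\kappa]$, whose edge set is $\bigcup_{uv\in E(G)}\mathscr M_{uv}$, where $\mathscr M_{uv}$ is a (possibly empty) matching between $X_u$ and $X_v$. A *valued cover* $(H,f)$ of $G$ is a cover $H$ with a function $f:V(H)\to\mathbb Z_{\ge 0}$. The *kernel* of $(H,f)$ is the subgraph of $H$ obtained by deleting all vertices $x$ with $f(x)=0$. A *transversal* is a set $R\subseteq V(H)$ with $|R\cap X_v|=1$ for all $v\in V(G)$; it is *strictly $f$-degenerate* if every nonempty subgraph $\Gamma$ of $H[R]$ has a vertex $x$ with $\deg_\Gamma(x)<f(x)$. The *circular ladder* on $[n]\times[2]$ is the disjoint union of the two cycles $(1,j),(2,j),\dots,(n,j),(1,j)$, $j=1,2$. The *Möbius ladder* on $[n]\times[2]$ has the edges $(i,j)(i+1,j)$ for $1\le i\le n-1$, $j\in[2]$, and the edges $(n,1)(1,2)$, $(n,2)(1,1)$. A *building cover* is a valued cover $(H,f)$ of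 a graph $B$ with $\sum_{q=1}^{\kappa}f(v,q)=\deg_B(v)$ for all $v\in V(B)$ such that at least one of the following holds: (i) the kernel is isomorphic to $B$; (ii) $B\cong K_p$ for some $p\ge 2$, the kernel is isomorphic to the Cartesian product of $K_p$ with an edgeless graph on $k$ vertices for some $k$, and $f$ is constant on each component of the kernel; (iii) $B$ is an odd cycle of length $n$, the kernel is isomorphic to the circular ladder on $[n]\times[2]$, and $f=1$ on the kernel; (iv) $B$ is an even cycle of length $n$, the kernel is isomorphic to the Möbius ladder on $[n]\times[2]$, and $f=1$ on the kernel. *Constructible* valued covers are defined recursively. Every building cover is constructible. If $(H_1,f_1)$ and $(H_2,f_2)$ are constructible valued covers of disjoint graphs $G_1$ and $G_2$ (with the same $\kappa$), $w_1\in V(G_1)$ and $w_2\in V(G_2)$, then the following valued cover $(H,f)$ of $G$ is constructible: $G$ arises from $G_1\cup G_2$ by identifying $w_1$ and $w_2$ to a vertex $w$; $H$ arises from $H_1\cup H_2$ by identifying $(w_1,q)$ and $(w_2,q)$ to $(w,q)$ for each $q\in[\kappa]$; $f(w,q)=f_1(w_1,q)+f_2(w_2,q)$ for each $q$, and $f$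 agrees with $f_1$ and $f_2$ on the remaining vertices of $H_1$ and $H_2$. **Theorem.** Let $G$ be a connected graph and let $(H,f)$ be a valued cover of $G$ with $f(v,1)+\dots+f(v,\kappa)\ge\deg_G(v)$ for every $v\in V(G)$. Assume that $f$ is not identically zero (this excludes only the case in which $G$ has a single vertex and $f\equiv 0$). Then $H$ has a strictly $f$-degenerate transversal $R$ with $\deg_{H[R]}(v,q)\le f(v,q)$ for every $(v,q)\in R$ if and only if $(H,f)$ is not constructible. -/

import Mathlib

universe u

namespace CoverDegeneracy

/-- The degree of a vertex, as the number of its neighbours. It is used for finite graphs only. -/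
noncomputable def vdeg {W : Type*} (K : SimpleGraph W) (x : W) : ℕ := (K.neighborSet x).ncard

/-- A graph `K` is strictly `f`-degenerate if every nonempty subgraph `Γ` of `K` has a vertex `x`
with `deg_Γ(x) < f(x)`. -/
def StrictlyDegenerate {W : Type*} (K : SimpleGraph W) (f : W → ℕ) : Prop :=
  ∀ Γ : K.Subgraph, Γ.verts.Nonempty → ∃ x ∈ Γ.verts, (Γ.neighborSet x).ncard < f x

/-- A valued cover `(H, f)` of `G` with `κ` colours: `H` is a graph on `⋃ X_v`, where
`X_v = {v} × [κ]`, every edge of `H` lies over an edge of `G`, and the edges between `X_u` and `X_v`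
form a (possibly empty) matching; `f` is a nonnegative integer valued function on `V(H)`. -/
structure ValuedCover {V : Type u} (G : SimpleGraph V) (κ : ℕ) where
  /-- the cover `H` -/
  graph : SimpleGraph (V × Fin κ)
  /-- the function `f` -/
  val : V × Fin κ → ℕ
  adj_fst : ∀ x y, graph.Adj x y → G.Adj x.1 y.1
  matching : ∀ x y z, graph.Adj x y → graph.Adj x z → y.1 = z.1 → y = z

/-- The Cartesian product of the complete graph on `p` vertices and an independent `k`-set. -/
def completeLadder (p k : ℕ) : SimpleGraph (Fin p × Fin k) :=
  SimpleGraph.boxProd (⊤ : SimpleGraph (Fin p)) (⊥ : SimpleGraph (Fin k))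

/-- The circular ladder graph: the Cartesian product of the cycle on `n` vertices and an
independent set with two vertices. -/
def circularLadder (n : ℕ) : SimpleGraph (Fin n × Fin 2) :=
  SimpleGraph.boxProd (SimpleGraph.cycleGraph n) (⊥ : SimpleGraph (Fin 2))

/-- The Möbius ladder: two copies of the path `0, 1, …, n - 1`, with the last layer joined to the
first layer crosswise (`fromRel` symmetrizes). -/
def mobiusLadder (n : ℕ) : SimpleGraph (Fin n × Fin 2) :=
  SimpleGraph.fromRel fun x y =>
    (x.1.val + 1 = y.1.val ∧ x.2 = y.2) ∨
      (x.1.val + 1 = n ∧ y.1.val = 0 ∧ x.2 ≠ y.2)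

namespace ValuedCover

variable {V : Type u} {G : SimpleGraph V} {κ : ℕ}

/-- The vertices `x` of `H` with `f x ≠ 0`. -/
def kernelVerts (C : ValuedCover G κ) : Set (V × Fin κ) := {x | C.val x ≠ 0}

/-- The kernel of `H`: delete each vertex with `f`-value zero. -/
def kernel (C : ValuedCover G κ) : SimpleGraph C.kernelVerts := C.graph.induce C.kernelVerts

/-- A monoblock (apart from the degree equation): the kernel is isomorphic to the base graph. -/
def IsMonoblock (C : ValuedCover G κ) : Prop := Nonempty (C.kernel ≃g G)

/-- The base graph is a complete graph with at least two vertices, the kernel is isomorphic to its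
Cartesian product with an independent set, and `f` is constant on each component of the kernel. -/
def IsCompleteType (C : ValuedCover G κ) : Prop :=
  ∃ p k : ℕ, 2 ≤ p ∧ Nonempty (G ≃g (⊤ : SimpleGraph (Fin p))) ∧
    Nonempty (C.kernel ≃g completeLadder p k) ∧
    ∀ x y : C.kernelVerts, C.kernel.Reachable x y → C.val x = C.val y

/-- The base graph is an odd cycle, the kernel is a circular ladder, `f ≡ 1` on the kernel. -/
def IsOddCycleType (C : ValuedCover G κ) : Prop :=
  ∃ n : ℕ, 3 ≤ n ∧ Odd n ∧ Nonempty (G ≃g SimpleGraph.cycleGraph n) ∧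
    Nonempty (C.kernel ≃g circularLadder n) ∧ ∀ x ∈ C.kernelVerts, C.val x = 1

/-- The base graph is an even cycle, the kernel is a Möbius ladder, `f ≡ 1` on the kernel. -/
def IsEvenCycleType (C : ValuedCover G κ) : Prop :=
  ∃ n : ℕ, 3 ≤ n ∧ Even n ∧ Nonempty (G ≃g SimpleGraph.cycleGraph n) ∧
    Nonempty (C.kernel ≃g mobiusLadder n) ∧ ∀ x ∈ C.kernelVerts, C.val x = 1

/-- Building covers. -/
def IsBuilding (C : ValuedCover G κ) : Prop :=
  (∀ v, ∑ q, C.val (v, q) = vdeg G v) ∧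
    (C.IsMonoblock ∨ C.IsCompleteType ∨ C.IsOddCycleType ∨ C.IsEvenCycleType)

/-- `R` is a transversal: it meets each `X_v` in exactly one vertex. -/
def IsTransversal (_C : ValuedCover G κ) (R : Set (V × Fin κ)) : Prop :=
  ∀ v, ∃! q, (v, q) ∈ R

/-- `R` is a strictly `f`-degenerate transversal: a transversal such that `H[R]` is strictly
`f`-degenerate. -/
def IsStrictlyDegenerateTransversal (C : ValuedCover G κ) (R : Set (V × Fin κ)) : Prop :=
  C.IsTransversal R ∧ StrictlyDegenerate (C.graph.induce R) fun x => C.val x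

/-- `C` is obtained from the valued covers `C₁` and `C₂` by identifying the vertices `w₁` and `w₂`
of the base graphs, identifying `(w₁, q)` with `(w₂, q)` for every colour `q`, and adding the
values there. The injections `i₁` and `i₂` locate the two parts in the glued object. -/
structure IsGluing {V₁ V₂ : Type u} {G₁ : SimpleGraph V₁} {G₂ : SimpleGraph V₂}
    (C : ValuedCover G κ) (C₁ : ValuedCover G₁ κ) (C₂ : ValuedCover G₂ κ)
    (i₁ : V₁ ↪ V) (i₂ : V₂ ↪ V) (w₁ : V₁) (w₂ : V₂) : Prop where
  exhaust : ∀ v, (∃ a, i₁ a = v) ∨ ∃ b, i₂ b = v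
  overlap : ∀ a b, i₁ a = i₂ b ↔ a = w₁ ∧ b = w₂
  base_adj : ∀ u v, G.Adj u v ↔
    (∃ a a', i₁ a = u ∧ i₁ a' = v ∧ G₁.Adj a a') ∨ ∃ b b', i₂ b = u ∧ i₂ b' = v ∧ G₂.Adj b b'
  cover_adj : ∀ u p v q, C.graph.Adj (u, p) (v, q) ↔
    (∃ a a', i₁ a = u ∧ i₁ a' = v ∧ C₁.graph.Adj (a, p) (a', q)) ∨
      ∃ b b', i₂ b = u ∧ i₂ b' = v ∧ C₂.graph.Adj (b, p) (b', q)
  val_glue : ∀ q, C.val (i₁ w₁, q) = C₁.val (w₁, q) + C₂.val (w₂, q)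
  val_left : ∀ a q, a ≠ w₁ → C.val (i₁ a, q) = C₁.val (a, q)
  val_right : ∀ b q, b ≠ w₂ → C.val (i₂ b, q) = C₂.val (b, q)

/-- Constructible valued covers (of finite graphs): the building covers, and all valued covers
obtained from two constructible ones by gluing at a vertex. -/
inductive Constructible {κ : ℕ} : ∀ {V : Type u} {G : SimpleGraph V}, ValuedCover G κ → Prop
  | building {V : Type u} [Finite V] {G : SimpleGraph V} (C : ValuedCover G κ)
      (h : C.IsBuilding) : Constructible C
  | glue {V V₁ V₂ : Type u} {G : SimpleGraph V} {G₁ : SimpleGraph V₁} {G₂ : SimpleGraph V₂}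
      (C : ValuedCover G κ) (C₁ : ValuedCover G₁ κ) (C₂ : ValuedCover G₂ κ)
      (i₁ : V₁ ↪ V) (i₂ : V₂ ↪ V) (w₁ : V₁) (w₂ : V₂)
      (h : C.IsGluing C₁ C₂ i₁ i₂ w₁ w₂)
      (h₁ : Constructible C₁) (h₂ : Constructible C₂) : Constructible C

end ValuedCover

end CoverDegeneracy

namespace CoverDegeneracy

section

open Finset
open scoped Classical

/-! ### Graphs without cut vertices: ear-type extension and reductions -/

section Connectivity

variable {V : Type u} {G : SimpleGraph V} {A B D M S X Y : Finset V}

/-- The vertex set `A` induces a connected (possibly empty) subgraph: every nonempty proper subset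
of `A` is joined to the rest of `A`. -/
def Conn (G : SimpleGraph V) (A : Finset V) : Prop :=
  ∀ B ⊆ A, B.Nonempty → B ≠ A → ∃ u ∈ B, ∃ v ∈ A, v ∉ B ∧ G.Adj u v

/-- `A` induces a connected subgraph without cut vertices. -/
structure NoCut (G : SimpleGraph V) (A : Finset V) : Prop where
  conn : Conn G A
  erase : ∀ v ∈ A, Conn G (A.erase v)

/-- The number of neighbours of `v` in `A`. -/
noncomputable def degIn (G : SimpleGraph V) (A : Finset V) (v : V) : ℕ := #{u ∈ A | G.Adj v u}

/-- Passing to the complement reverses the two ends of a crossing edge, so only sets avoiding a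
fixed root need to be tested. -/
theorem Conn.of_root {z : V} (_ : z ∈ A)
    (h : ∀ B ⊆ A, B.Nonempty → z ∉ B → ∃ u ∈ B, ∃ v ∈ A, v ∉ B ∧ G.Adj u v) : Conn G A := by
  intro B hB hne hBA
  by_cases hzB : z ∈ B
  · have hne' : (A \ B).Nonempty := by
      rw [sdiff_nonempty]
      exact fun h' => hBA (Subset.antisymm hB h')
    obtain ⟨u, hu, v, hv, hvB, huv⟩ := h (A \ B) sdiff_subset hne' (by simp [hzB])
    simp only [mem_sdiff, not_and, not_not] at hu hvB
    exact ⟨v, hvB hv, u, hu.1, hu.2, huv.symm⟩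
  · exact h B hB hne hzB

theorem Conn.singleton (v : V) : Conn G {v} := by
  refine Conn.of_root (mem_singleton_self v) fun B hB hne hv => ?_
  obtain ⟨x, hx⟩ := hne
  have := mem_singleton.1 (hB hx)
  exact absurd (this ▸ hx) hv

theorem Conn.union (hX : Conn G X) (hY : Conn G Y) {x y : V} (hx : x ∈ X) (hy : y ∈ Y)
    (hxy : x = y ∨ G.Adj x y) : Conn G (X ∪ Y) := by
  refine Conn.of_root (mem_union_left _ hx) fun B hB hne hxB => ?_
  by_cases hBX : (B ∩ X).Nonempty
  · obtain ⟨u, hu, v, hv, hvB, huv⟩ := hX (B ∩ X) inter_subset_right hBX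
      (fun h => hxB (mem_inter.1 (h ▸ hx)).1)
    refine ⟨u, (mem_inter.1 hu).1, v, mem_union_left _ hv, fun h => hvB (mem_inter.2 ⟨h, hv⟩), huv⟩
  · have hBY : B ⊆ Y := fun z hz => (mem_union.1 (hB hz)).resolve_left
      fun h => hBX ⟨z, mem_inter.2 ⟨hz, h⟩⟩
    by_cases hBeq : B = Y
    · subst hBeq
      rcases hxy with rfl | hxy
      · exact absurd hy hxB
      · exact ⟨y, hy, x, mem_union_left _ hx, hxB, hxy.symm⟩
    · obtain ⟨u, hu, v, hv, hvB, huv⟩ := hY B hBY hne hBeq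
      exact ⟨u, hu, v, mem_union_right _ hv, hvB, huv⟩

theorem Conn.insert_of_adj (hX : Conn G X) {x v : V} (hx : x ∈ X) (hxv : G.Adj x v) :
    Conn G (insert v X) := by
  rw [insert_eq, union_comm]
  exact hX.union (Conn.singleton v) hx (mem_singleton_self v) (Or.inr hxv)

theorem Conn.exists_adj (hA : Conn G A) {x y : V} (hx : x ∈ A) (hy : y ∈ A) (hxy : x ≠ y) :
    ∃ z ∈ A, z ≠ x ∧ G.Adj x z := by
  obtain ⟨u, hu, v, hv, hvB, huv⟩ := hA {x} (by simpa using hx) (singleton_nonempty x)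
    (fun h => hxy (mem_singleton.1 (h ▸ hy)).symm)
  rw [mem_singleton] at hu hvB
  exact ⟨v, hv, hvB, hu ▸ huv⟩

/-- A connected set with two elements has a non-cut vertex different from a given vertex. -/
theorem Conn.exists_ne_erase (hS : Conn G S) {w : V} (hw : w ∈ S) (h2 : 2 ≤ #S) :
    ∃ u ∈ S, u ≠ w ∧ Conn G (S.erase u) := by
  let F : Finset (Finset V) := {T ∈ S.powerset | w ∈ T ∧ T ≠ S ∧ Conn G T}
  have hF : F.Nonempty := ⟨{w}, by
    simp only [F, mem_filter, mem_powerset, singleton_subset_iff, mem_singleton, true_and]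
    refine ⟨hw, fun h => ?_, Conn.singleton w⟩
    rw [← h, card_singleton] at h2
    omega⟩
  obtain ⟨T, hT, hmax⟩ := exists_max_image F card hF
  simp only [F, mem_filter, mem_powerset] at hT
  obtain ⟨hTS, hwT, hne, hTc⟩ := hT
  obtain ⟨u, hu, v, hv, hvT, huv⟩ := hS T hTS ⟨w, hwT⟩ hne
  have heq : insert v T = S := by
    by_contra hcon
    have := hmax (insert v T) (by
      simp only [F, mem_filter, mem_powerset]
      exact ⟨insert_subset hv hTS, mem_insert_of_mem hwT, hcon, hTc.insert_of_adj hu huv⟩)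
    rw [card_insert_of_notMem hvT] at this
    omega
  refine ⟨v, hv, fun h => hvT (h ▸ hwT), ?_⟩
  rw [← heq, erase_insert hvT]
  exact hTc

theorem NoCut.pair {x y : V} (h : G.Adj x y) : NoCut G {x, y} := by
  refine ⟨(Conn.singleton y).insert_of_adj (mem_singleton_self y) h.symm, fun v hv => ?_⟩
  have hne := h.ne
  simp only [mem_insert, mem_singleton] at hv
  rcases hv with rfl | rfl
  · rw [erase_insert (by simpa using hne)]
    exact Conn.singleton y
  · have : ({x, v} : Finset V).erase v = {x} := by
      ext z
      simp only [mem_erase, mem_insert, mem_singleton]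
      constructor
      · rintro ⟨h1, h2⟩
        exact h2.resolve_right h1
      · rintro rfl
        exact ⟨hne, Or.inl rfl⟩
    rw [this]
    exact Conn.singleton x

/-- `D` has neighbours at two different vertices of `M`. -/
def Attached (G : SimpleGraph V) (M D : Finset V) : Prop :=
  ∃ a ∈ M, ∃ b ∈ M, a ≠ b ∧ (∃ x ∈ D, G.Adj a x) ∧ ∃ y ∈ D, G.Adj b y

theorem Attached.exists_ne (h : Attached G M D) (z : V) :
    ∃ a ∈ M, a ≠ z ∧ ∃ x ∈ D, G.Adj a x := by
  obtain ⟨a, ha, b, hb, hab, hx, hy⟩ := h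
  by_cases haz : a = z
  · exact ⟨b, hb, fun h => hab (haz.trans h.symm), hy⟩
  · exact ⟨a, ha, haz, hx⟩

/-- Adding a minimal connected set with two attachments creates no cut vertex. -/
theorem NoCut.union_of_minimal (hM : NoCut G M) (hdisj : Disjoint M D)
    (hD : Conn G D) (hatt : Attached G M D)
    (hmin : ∀ E ⊆ D, Conn G E → Attached G M E → E = D) : NoCut G (M ∪ D) := by
  obtain ⟨a, ha, b, hb, hab, ⟨x, hx, hax⟩, y, hy, hby⟩ := id hatt
  refine ⟨hM.conn.union hD ha hx (Or.inr hax), fun z hz => ?_⟩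
  by_cases hzM : z ∈ M
  · have hzD : z ∉ D := disjoint_left.1 hdisj hzM
    obtain ⟨a', ha', haz, x', hx', hax'⟩ := hatt.exists_ne z
    rw [erase_union_distrib, erase_eq_of_notMem hzD]
    exact (hM.erase z hzM).union hD (mem_erase.2 ⟨haz, ha'⟩) hx' (Or.inr hax')
  have hzD : z ∈ D := (mem_union.1 hz).resolve_left hzM
  -- A largest member `T` is the component of `M` after deleting `z`; the aim is to show that it is
  -- everything.
  let F : Finset (Finset V) := {T ∈ ((M ∪ D).erase z).powerset | M ⊆ T ∧ Conn G T}
  have hF : F.Nonempty := ⟨M, by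
    simp only [F, mem_filter, mem_powerset, subset_erase]
    exact ⟨⟨subset_union_left, hzM⟩, Subset.refl _, hM.conn⟩⟩
  obtain ⟨T, hT, hmax⟩ := exists_max_image F card hF
  simp only [F, mem_filter, mem_powerset, subset_erase] at hT
  obtain ⟨⟨hTU, hzT⟩, hMT, hTc⟩ := hT
  have hsep : ∀ u ∈ T, ∀ v ∈ M ∪ D, v ≠ z → v ∉ T → ¬ G.Adj u v := by
    intro u hu v hv hvz hvT huv
    have := hmax (insert v T) (by
      simp only [F, mem_filter, mem_powerset, subset_erase]
      refine ⟨⟨insert_subset hv hTU, ?_⟩, hMT.trans (subset_insert _ _), hTc.insert_of_adj hu huv⟩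
      simp only [mem_insert, not_or]
      exact ⟨hvz.symm, hzT⟩)
    rw [card_insert_of_notMem hvT] at this
    omega
  -- Parts of `D` cut off from `M` by `z` could be dropped without losing connectedness or
  -- attachments, so minimality of `D` rules them out.
  have hE : ({v ∈ D | v = z ∨ v ∈ T} : Finset V) = D := by
    refine hmin _ (filter_subset _ _) ?_ ?_
    · refine Conn.of_root (z := z) (by simp [hzD]) fun B hB hne hzB => ?_
      obtain ⟨u, hu, v, hv, hvB, huv⟩ := hD B (hB.trans (filter_subset _ _)) hne
        (fun h => hzB (h ▸ hzD))
      have hu' := (mem_filter.1 (hB hu)).2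
      have huT : u ∈ T := hu'.resolve_left fun h => hzB (h ▸ hu)
      refine ⟨u, hu, v, mem_filter.2 ⟨hv, ?_⟩, hvB, huv⟩
      by_contra hcon
      rw [not_or] at hcon
      exact hsep u huT v (mem_union_right _ hv) hcon.1 hcon.2 huv
    · have key : ∀ m ∈ M, ∀ x ∈ D, G.Adj m x → x ∈ ({v ∈ D | v = z ∨ v ∈ T} : Finset V) := by
        intro m hm x hx hmx
        refine mem_filter.2 ⟨hx, ?_⟩
        by_contra hcon
        rw [not_or] at hcon
        exact hsep m (hMT hm) x (mem_union_right _ hx) hcon.1 hcon.2 hmx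
      exact ⟨a, ha, b, hb, hab, ⟨x, key a ha x hx hax, hax⟩, y, key b hb y hy hby, hby⟩
  have hTeq : T = (M ∪ D).erase z := by
    refine Subset.antisymm (subset_erase.2 ⟨hTU, hzT⟩) fun v hv => ?_
    rw [mem_erase, mem_union] at hv
    rcases hv.2 with h | h
    · exact hMT h
    · rw [← hE] at h
      exact (mem_filter.1 h).2.resolve_left hv.1
  rw [← hTeq]
  exact hTc

/-- The complement of a maximal proper vertex set without cut vertices is connected, has two
attachments, and is minimal with these properties. -/
theorem NoCut.compl_of_maximal (hA : NoCut G A) (hM : NoCut G M) (hMA : M ⊆ A) (hne : M ≠ A)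
    (h2 : 2 ≤ #M) (hmax : ∀ M', M ⊆ M' → M' ⊆ A → M' ≠ M → NoCut G M' → M' = A) :
    Conn G (A \ M) ∧ Attached G M (A \ M) ∧
      ∀ D ⊆ A \ M, Conn G D → Attached G M D → D = A \ M := by
  have hmin : ∀ D ⊆ A \ M, Conn G D → Attached G M D → D = A \ M := by
    intro D hDS hD hatt
    -- A smallest attached connected `E` inside `D` can be added to `M` without creating a cut
    -- vertex; maximality of `M` then makes `M ∪ E` all of `A`.
    let F : Finset (Finset V) := {T ∈ D.powerset | Conn G T ∧ Attached G M T}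
    have hF : F.Nonempty := ⟨D, by simp [F, hD, hatt]⟩
    obtain ⟨E, hE, hminE⟩ := exists_min_image F card hF
    simp only [F, mem_filter, mem_powerset] at hE
    obtain ⟨hED, hEc, hEa⟩ := hE
    have hdisj : Disjoint M E :=
      disjoint_of_subset_right (hED.trans hDS) disjoint_sdiff
    have hNC : NoCut G (M ∪ E) := by
      refine hM.union_of_minimal hdisj hEc hEa fun E' hE' hc ha => ?_
      refine eq_of_subset_of_card_le hE' (hminE E' ?_)
      simp only [F, mem_filter, mem_powerset]
      exact ⟨hE'.trans hED, hc, ha⟩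
    have hEne : M ∪ E ≠ M := by
      obtain ⟨a, ha, b, hb, hab, ⟨x, hx, hax⟩, -⟩ := hEa
      intro h
      have : x ∈ M := h ▸ mem_union_right M hx
      exact disjoint_left.1 hdisj this hx
    have hall := hmax _ subset_union_left
      (union_subset hMA ((hED.trans hDS).trans sdiff_subset)) hEne hNC
    refine Subset.antisymm hDS ?_
    intro z hz
    rw [← hall, mem_sdiff, mem_union] at hz
    exact hED (hz.1.resolve_left hz.2)
  have hSne : (A \ M).Nonempty := by
    rw [sdiff_nonempty]
    exact fun h => hne (Subset.antisymm hMA h)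
  -- A largest member is a component of `A \ M`. It has a neighbour `a` in `M`, and since `a` is not
  -- a cut vertex of `A` it has a second one.
  let F : Finset (Finset V) := {T ∈ (A \ M).powerset | T.Nonempty ∧ Conn G T}
  have hF : F.Nonempty := by
    obtain ⟨s, hs⟩ := hSne
    refine ⟨{s}, ?_⟩
    simp only [F, mem_filter, mem_powerset, singleton_subset_iff]
    exact ⟨hs, singleton_nonempty s, Conn.singleton s⟩
  obtain ⟨D, hD, hmaxD⟩ := exists_max_image F card hF
  simp only [F, mem_filter, mem_powerset] at hD
  obtain ⟨hDS, hDne, hDc⟩ := hD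
  have hsep : ∀ u ∈ D, ∀ v ∈ A, v ∉ D → G.Adj u v → v ∈ M := by
    intro u hu v hv hvD huv
    by_contra hvM
    have := hmaxD (insert v D) (by
      simp only [F, mem_filter, mem_powerset]
      exact ⟨insert_subset (mem_sdiff.2 ⟨hv, hvM⟩) hDS, insert_nonempty _ _, hDc.insert_of_adj hu huv⟩)
    rw [card_insert_of_notMem hvD] at this
    omega
  have hDA : D ⊆ A := hDS.trans sdiff_subset
  have hDM : ∀ m ∈ M, m ∉ D := fun m hm h => (mem_sdiff.1 (hDS h)).2 hm
  have hatt : Attached G M D := by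
    obtain ⟨m, hm⟩ : M.Nonempty := card_pos.1 (by omega)
    obtain ⟨u, hu, a, ha, haD, hua⟩ := hA.conn D hDA hDne (fun h => hDM m hm (h ▸ hMA hm))
    have haM := hsep u hu a ha haD hua
    obtain ⟨m', hm', hma⟩ := exists_mem_ne (by omega : 1 < #M) a
    obtain ⟨u', hu', b, hb, hbD, hub⟩ := hA.erase a ha D
      (fun z hz => mem_erase.2 ⟨fun h => haD (h ▸ hz), hDA hz⟩) hDne
      (fun h => hDM m' hm' (h ▸ mem_erase.2 ⟨hma, hMA hm'⟩))
    rw [mem_erase] at hb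
    exact ⟨a, haM, b, hsep u' hu' b hb.2 hbD hub, hb.1.symm, ⟨u, hu, hua.symm⟩, u', hu', hub.symm⟩
  have hDeq := hmin D hDS hDc hatt
  exact ⟨hDeq ▸ hDc, hDeq ▸ hatt, hmin⟩

/-- If the complement of a maximal proper vertex set without cut vertices is not a single vertex,
then it has exactly two attachments, and each of them is used once. -/
theorem NoCut.attachments_of_maximal (hA : NoCut G A) (hM : NoCut G M) (hMA : M ⊆ A)
    (h2 : 2 ≤ #M) (hmax : ∀ M', M ⊆ M' → M' ⊆ A → M' ≠ M → NoCut G M' → M' = A)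
    (hS : 2 ≤ #(A \ M)) :
    ∃ a ∈ M, ∃ b ∈ M, ∃ x ∈ A \ M, ∃ y ∈ A \ M, a ≠ b ∧ G.Adj a x ∧ G.Adj b y ∧
      (∀ z ∈ A \ M, G.Adj a z → z = x) ∧ (∀ z ∈ A \ M, G.Adj b z → z = y) ∧
      ∀ m ∈ M, m ≠ a → m ≠ b → ∀ z ∈ A \ M, ¬ G.Adj m z := by
  have hne : M ≠ A := by
    rintro rfl
    simp at hS
  obtain ⟨hSc, hatt, hmin⟩ := hA.compl_of_maximal hM hMA hne h2 hmax
  set S := A \ M with hSdef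
  obtain ⟨a, ha, b, hb, hab, ⟨x, hx, hax⟩, y, hy, hby⟩ := hatt
  have hxS : ∀ {z}, z ∈ S → S.erase z ≠ S := fun {z} hz h => by
    exact notMem_erase z S (h.symm ▸ hz)
  have hsingle : ∀ z ∈ S, ¬ Attached G M {z} := by
    intro z hz h
    have := hmin {z} (by simpa using hz) (Conn.singleton z) h
    rw [← this, card_singleton] at hS
    omega
  have hxy : x ≠ y := by
    rintro rfl
    exact hsingle x hx ⟨a, ha, b, hb, hab, ⟨x, mem_singleton_self x, hax⟩, x,
      mem_singleton_self x, hby⟩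
  obtain ⟨u₁, hu₁, -, hc₁⟩ := hSc.exists_ne_erase hx hS
  obtain ⟨u₂, hu₂, hu₁₂, hc₂⟩ := hSc.exists_ne_erase hu₁ hS
  have hno : ∀ u ∈ S, Conn G (S.erase u) → ¬ Attached G M (S.erase u) := fun u hu hc h =>
    hxS hu (hmin _ (erase_subset _ _) hc h)
  -- `S` has at least two non-cut vertices, and deleting any of them must destroy an attachment.
  -- Hence they are exactly `x` and `y`, and any further edge from `M` to `S` would leave `S - x` or
  -- `S - y` attached, against minimality.
  have hor : ∀ u ∈ S, Conn G (S.erase u) → u = x ∨ u = y := by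
    intro u hu hc
    by_contra hcon
    rw [not_or] at hcon
    exact hno u hu hc ⟨a, ha, b, hb, hab, ⟨x, mem_erase.2 ⟨hcon.1 ∘ Eq.symm, hx⟩, hax⟩, y,
      mem_erase.2 ⟨hcon.2 ∘ Eq.symm, hy⟩, hby⟩
  have hcxy : Conn G (S.erase x) ∧ Conn G (S.erase y) := by
    rcases hor u₁ hu₁ hc₁ with rfl | rfl <;> rcases hor u₂ hu₂ hc₂ with rfl | rfl
    · exact absurd rfl hu₁₂
    · exact ⟨hc₁, hc₂⟩
    · exact ⟨hc₂, hc₁⟩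
    · exact absurd rfl hu₁₂
  refine ⟨a, ha, b, hb, x, hx, y, hy, hab, hax, hby, ?_, ?_, ?_⟩
  · intro z hz haz
    by_contra hzx
    exact hno x hx hcxy.1 ⟨a, ha, b, hb, hab, ⟨z, mem_erase.2 ⟨hzx, hz⟩, haz⟩, y,
      mem_erase.2 ⟨hxy.symm, hy⟩, hby⟩
  · intro z hz hbz
    by_contra hzy
    exact hno y hy hcxy.2 ⟨a, ha, b, hb, hab, ⟨x, mem_erase.2 ⟨hxy, hx⟩, hax⟩, z,
      mem_erase.2 ⟨hzy, hz⟩, hbz⟩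
  · intro m hm hma hmb z hz hmz
    by_cases hzx : z = x
    · subst hzx
      exact hno y hy hcxy.2 ⟨a, ha, m, hm, hma.symm, ⟨z, mem_erase.2 ⟨hxy, hz⟩, hax⟩, z,
        mem_erase.2 ⟨hxy, hz⟩, hmz⟩
    · exact hno x hx hcxy.1 ⟨m, hm, b, hb, hmb, ⟨z, mem_erase.2 ⟨hzx, hz⟩, hmz⟩, y,
        mem_erase.2 ⟨hxy.symm, hy⟩, hby⟩

/-- `S` is a part of `A` whose removal leaves no cut vertex, and the remaining set has an edge `ac`
such that `v` is the only neighbour of `a` in `S`, and `c` has no neighbour in `S`. -/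
structure IsReduction (G : SimpleGraph V) (A S : Finset V) (v a c : V) : Prop where
  subset : S ⊆ A
  mem : v ∈ S
  left_mem : a ∈ A \ S
  right_mem : c ∈ A \ S
  adj : G.Adj a c
  adj_mem : G.Adj a v
  unique : ∀ z ∈ S, G.Adj a z → z = v
  not_adj : ∀ z ∈ S, ¬ G.Adj c z
  noCut : NoCut G (A \ S)

theorem conn_of_dominating {v : V} (hv : v ∈ A) (h : ∀ u ∈ A, u ≠ v → G.Adj v u) : Conn G A :=
  Conn.of_root hv fun _ hB ⟨u, hu⟩ hvB =>
    ⟨u, hu, v, hv, hvB, (h u (hB hu) (fun e => hvB (e ▸ hu))).symm⟩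

theorem isReduction_singleton {v a c : V} (hv : v ∈ A) (ha : a ∈ A.erase v)
    (hc : c ∈ A.erase v) (hac : G.Adj a c) (hav : G.Adj a v) (hcv : ¬ G.Adj c v)
    (h : NoCut G (A.erase v)) : IsReduction G A {v} v a c := by
  have he : A \ {v} = A.erase v := sdiff_singleton_eq_erase v A
  exact ⟨by simpa using hv, mem_singleton_self v, he ▸ ha, he ▸ hc, hac, hav,
    fun z hz _ => mem_singleton.1 hz, fun z hz => (mem_singleton.1 hz) ▸ hcv, he ▸ h⟩

/-- A graph without cut vertices is complete, or `2`-regular, or it has a reduction. -/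
theorem NoCut.exists_reduction (hA : NoCut G A) (h2 : 2 ≤ #A) :
    (∀ u ∈ A, ∀ v ∈ A, u ≠ v → G.Adj u v) ∨ (∀ v ∈ A, degIn G A v = 2) ∨
      ∃ S v a c, IsReduction G A S v a c := by
  by_cases hcomp : ∀ u ∈ A, ∀ v ∈ A, u ≠ v → G.Adj u v
  · exact Or.inl hcomp
  refine Or.inr ?_
  push Not at hcomp
  obtain ⟨p, hp, q, hq, hpq, hnadj⟩ := hcomp
  have hnbr : ∀ v ∈ A, ∃ y ∈ A, y ≠ v ∧ G.Adj v y := by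
    intro v hv
    obtain ⟨w, hw, hwv⟩ := exists_mem_ne (by omega : 1 < #A) v
    exact hA.conn.exists_adj hv hw hwv.symm
  have h3 : 4 ≤ #A := by
    by_contra hlt
    obtain ⟨r, hr, hrp, hpr⟩ := hnbr p hp
    have hrq : r ≠ q := by
      rintro rfl
      exact hnadj hpr
    have hsub : ({p, q, r} : Finset V) ⊆ A := by
      simp [insert_subset_iff, hp, hq, hr]
    have hcard : #({p, q, r} : Finset V) = 3 := card_eq_three.2 ⟨p, q, r, hpq, hrp.symm, hrq.symm, rfl⟩
    have heq : ({p, q, r} : Finset V) = A := eq_of_subset_of_card_le hsub (by omega)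
    obtain ⟨z, hz, hzp, hpz⟩ := (hA.erase r hr).exists_adj (mem_erase.2 ⟨hrp.symm, hp⟩)
      (mem_erase.2 ⟨hrq.symm, hq⟩) hpq
    rw [← heq] at hz
    simp only [mem_erase, mem_insert, mem_singleton] at hz
    rcases hz.2 with h | h | h
    · exact hzp h
    · exact hnadj (h ▸ hpz)
    · exact hz.1 h
  -- A largest proper set `M` without cut vertices is used. Edges belong to the family because `A`
  -- has at least four vertices.
  let F : Finset (Finset V) := {T ∈ A.powerset | T ≠ A ∧ 2 ≤ #T ∧ NoCut G T}
  have hpair : ∀ v ∈ A, ∀ y ∈ A, G.Adj v y → ({v, y} : Finset V) ∈ F := by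
    intro v hv y hy hvy
    simp only [F, mem_filter, mem_powerset]
    have hc : #({v, y} : Finset V) = 2 := card_pair hvy.ne
    refine ⟨by simp [insert_subset_iff, hv, hy], fun h => ?_, hc.ge, NoCut.pair hvy⟩
    rw [h] at hc
    omega
  have hF : F.Nonempty := by
    obtain ⟨y, hy, -, hpy⟩ := hnbr p hp
    exact ⟨_, hpair p hp y hy hpy⟩
  obtain ⟨M, hM, hmaxM⟩ := exists_max_image F card hF
  have hmaximal : ∀ N ∈ F, #N = #M → ∀ M', N ⊆ M' → M' ⊆ A → M' ≠ N → NoCut G M' → M' = A := by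
    intro N hN hcard M' hNM' hM'A hne hnc
    by_contra hcon
    have hlt : #N < #M' := card_lt_card (hNM'.ssubset_of_ne hne.symm)
    simp only [F, mem_filter, mem_powerset] at hN
    have := hmaxM M' (by
      simp only [F, mem_filter, mem_powerset]
      exact ⟨hM'A, hcon, by omega, hnc⟩)
    omega
  have hM' := hM
  simp only [F, mem_filter, mem_powerset] at hM'
  obtain ⟨hMA, hMne, hM2, hMnc⟩ := hM'
  -- If the largest size is two, every edge is a maximal set, so each end has exactly one neighbour
  -- beyond the edge: the graph is 2-regular.
  by_cases hMcard : #M = 2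
  · left
    intro v hv
    obtain ⟨y, hy, hyv, hvy⟩ := hnbr v hv
    have hN := hpair v hv y hy hvy
    have hNcard : #({v, y} : Finset V) = 2 := card_pair hvy.ne
    have hNA : ({v, y} : Finset V) ⊆ A := by simp [insert_subset_iff, hv, hy]
    have hS2 : 2 ≤ #(A \ {v, y}) := by
      rw [card_sdiff_of_subset hNA]
      omega
    obtain ⟨a, ha, b, hb, x, hx, x', hx', hab, hax, hbx', hua, hub, -⟩ :=
      hA.attachments_of_maximal (NoCut.pair hvy) hNA hNcard.ge
        (hmaximal _ hN (by omega)) hS2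
    have key : ∀ s ∈ A \ {v, y}, G.Adj v s → (∀ z ∈ A \ {v, y}, G.Adj v z → z = s) →
        degIn G A v = 2 := by
      intro s hs hvs hus
      have : ({u ∈ A | G.Adj v u} : Finset V) = {y, s} := by
        ext z
        simp only [mem_filter, mem_insert, mem_singleton]
        constructor
        · rintro ⟨hz, hvz⟩
          by_cases hzy : z = y
          · exact Or.inl hzy
          · refine Or.inr (hus z ?_ hvz)
            simp only [mem_sdiff, mem_insert, mem_singleton, not_or]
            exact ⟨hz, hvz.ne', hzy⟩
        · rintro (rfl | rfl)
          · exact ⟨hy, hvy⟩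
          · exact ⟨(mem_sdiff.1 hs).1, hvs⟩
      unfold degIn
      rw [this, card_pair]
      rintro rfl
      simp at hs
    simp only [mem_insert, mem_singleton] at ha hb
    rcases ha with rfl | rfl
    · exact key x hx hax hua
    · rcases hb with rfl | rfl
      · exact key x' hx' hbx' hub
      · exact absurd rfl hab
  · right
    have hM3 : 3 ≤ #M := by omega
    have hSpos : 0 < #(A \ M) := by
      rw [card_pos, sdiff_nonempty]
      exact fun h => hMne (Subset.antisymm hMA h)
    by_cases hS2 : 2 ≤ #(A \ M)
    · obtain ⟨a, ha, b, hb, x, hx, -, -, hab, hax, -, hua, -, hother⟩ :=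
        hA.attachments_of_maximal hMnc hMA hM2 (hmaximal M hM rfl) hS2
      -- The vertex `c` is a neighbour of the attachment `a` inside `M`, found in the connected set
      -- `M - b`; being different from `a` and `b`, it has no neighbour in `A \ M`.
      obtain ⟨d, hd, hda⟩ := exists_mem_ne (s := M.erase b)
        (by rw [card_erase_of_mem hb]; omega) a
      obtain ⟨c, hc, hca, hac⟩ := (hMnc.erase b hb).exists_adj (mem_erase.2 ⟨hab, ha⟩) hd hda.symm
      rw [mem_erase] at hc
      have hsd : A \ (A \ M) = M := by rw [sdiff_sdiff_right_self, inf_eq_inter, inter_eq_right.2 hMA]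
      exact ⟨A \ M, x, a, c, sdiff_subset, hx, by rwa [hsd], by rw [hsd]; exact hc.2, hac, hax,
        hua, hother c hc.2 hca hc.1, by rwa [hsd]⟩
    · obtain ⟨v, hv⟩ := card_eq_one.1 (by omega : #(A \ M) = 1)
      have hvA : v ∈ A \ M := hv ▸ mem_singleton_self v
      rw [mem_sdiff] at hvA
      have hMe : M = A.erase v := by
        rw [← sdiff_singleton_eq_erase, ← hv, sdiff_sdiff_right_self, inf_eq_inter,
          inter_eq_right.2 hMA]
      subst hMe
      obtain ⟨y, hy, hyv, hvy⟩ := hnbr v hvA.1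
      -- Here `M = A - v`. If `v` is adjacent to everything, a vertex `p` with a non-neighbour `q`
      -- is removed instead, and `v` keeps the remainder free of cut vertices. Otherwise an edge of
      -- `M` leaving the neighbourhood of `v` gives `a` and `c`.
      by_cases hdom : ∀ u ∈ A, u ≠ v → G.Adj v u
      · have hpv : p ≠ v := by
          rintro rfl
          exact hnadj (hdom q hq hpq.symm)
        have hqv : q ≠ v := by
          rintro rfl
          exact hnadj (hdom p hp hpq).symm
        refine ⟨{p}, p, v, q, isReduction_singleton hp (mem_erase.2 ⟨hpv.symm, hvA.1⟩)
          (mem_erase.2 ⟨hpq.symm, hq⟩) (hdom q hq hqv) (hdom p hp hpv) (fun h => hnadj h.symm) ?_⟩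
        refine ⟨conn_of_dominating (mem_erase.2 ⟨hpv.symm, hvA.1⟩)
          fun u hu => hdom u (mem_erase.1 hu).2, fun z hz => ?_⟩
        by_cases hzv : z = v
        · subst hzv
          rw [erase_right_comm]
          exact hMnc.erase p (mem_erase.2 ⟨hpv, hp⟩)
        · exact conn_of_dominating (mem_erase.2 ⟨Ne.symm hzv, mem_erase.2 ⟨hpv.symm, hvA.1⟩⟩)
            fun u hu => hdom u (mem_erase.1 (mem_erase.1 hu).2).2
      · push Not at hdom
        obtain ⟨u, hu, huv, hnvu⟩ := hdom
        obtain ⟨a, ha, c, hc, hcN, hac⟩ := hMnc.conn ({z ∈ A.erase v | G.Adj v z} : Finset V)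
          (filter_subset _ _) ⟨y, mem_filter.2 ⟨mem_erase.2 ⟨hyv, hy⟩, hvy⟩⟩
          (fun h => hnvu (mem_filter.1 (h ▸ mem_erase.2 ⟨huv, hu⟩)).2)
        rw [mem_filter] at ha
        exact ⟨{v}, v, a, c, isReduction_singleton hvA.1 ha.1 hc hac ha.2.symm
          (fun h => hcN (mem_filter.2 ⟨hc, h.symm⟩)) hMnc⟩

end Connectivity

/-! ### Strictly degenerate choices, critical sets and their rigidity -/

section Degenerate

variable {V : Type u} {G : SimpleGraph V} {κ : ℕ} {A B S T : Finset V}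

theorem degIn_mono (h : B ⊆ A) (v : V) : degIn G B v ≤ degIn G A v :=
  card_le_card (filter_subset_filter _ h)

theorem degIn_union (h : Disjoint S T) (v : V) :
    degIn G (S ∪ T) v = degIn G S v + degIn G T v := by
  unfold degIn
  rw [filter_union, card_union_of_disjoint (disjoint_filter_filter h)]

theorem degIn_sdiff_add (h : S ⊆ A) (v : V) : degIn G (A \ S) v + degIn G S v = degIn G A v := by
  rw [← degIn_union sdiff_disjoint, sdiff_union_of_subset h]

theorem degIn_erase_self (v : V) : degIn G (A.erase v) v = degIn G A v := by
  unfold degIn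
  congr 1
  ext u
  simp only [mem_filter, mem_erase]
  exact ⟨fun h => ⟨h.1.2, h.2⟩, fun h => ⟨⟨h.2.ne', h.1⟩, h.2⟩⟩

namespace ValuedCover

/-- The number of neighbours of `(v, q)` among the vertices `(u, c u)` with `u ∈ B`. -/
noncomputable def colDeg (C : ValuedCover G κ) (c : V → Fin κ) (B : Finset V) (v : V)
    (q : Fin κ) : ℕ := #{u ∈ B | C.graph.Adj (v, q) (u, c u)}

/-- The set of all `(v, c v)` with `v ∈ A` induces a strictly `f`-degenerate graph. -/
def Degen (C : ValuedCover G κ) (f : V × Fin κ → ℕ) (c : V → Fin κ) (A : Finset V) : Prop :=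
  ∀ B ⊆ A, B.Nonempty → ∃ v ∈ B, C.colDeg c B v (c v) < f (v, c v)

/-- `A` is connected, the degree condition holds on `A`, and no choice of one vertex from every
fibre over `A` is strictly `f`-degenerate. -/
structure Critical (C : ValuedCover G κ) (f : V × Fin κ → ℕ) (A : Finset V) : Prop where
  conn : Conn G A
  degIn_le : ∀ v ∈ A, degIn G A v ≤ ∑ q, f (v, q)
  bad : ∀ c, ¬ C.Degen f c A

/-- The values that remain for the other fibres after choosing `(v, c v)` for all `v ∈ S`. -/
noncomputable def reduce (C : ValuedCover G κ) (f : V × Fin κ → ℕ) (c : V → Fin κ)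
    (S : Finset V) : V × Fin κ → ℕ := fun x => f x - C.colDeg c S x.1 x.2

variable {C : ValuedCover G κ} {f : V × Fin κ → ℕ} {c c' : V → Fin κ}

theorem colDeg_mono (h : B ⊆ A) (v : V) (q : Fin κ) : C.colDeg c B v q ≤ C.colDeg c A v q :=
  card_le_card (filter_subset_filter _ h)

theorem colDeg_congr (h : ∀ u ∈ B, c u = c' u) (v : V) (q : Fin κ) :
    C.colDeg c B v q = C.colDeg c' B v q := by
  unfold colDeg
  congr 1
  exact filter_congr fun u hu => by rw [h u hu]

theorem colDeg_union (h : Disjoint S T) (v : V) (q : Fin κ) :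
    C.colDeg c (S ∪ T) v q = C.colDeg c S v q + C.colDeg c T v q := by
  unfold colDeg
  rw [filter_union, card_union_of_disjoint (disjoint_filter_filter h)]

theorem colDeg_insert {u : V} (hu : u ∉ B) (v : V) (q : Fin κ) :
    C.colDeg c (insert u B) v q =
      (if C.graph.Adj (v, q) (u, c u) then 1 else 0) + C.colDeg c B v q := by
  rw [insert_eq, colDeg_union (disjoint_singleton_left.2 hu)]
  unfold colDeg
  rw [filter_singleton]
  split_ifs <;> simp

theorem colDeg_singleton (u v : V) (q : Fin κ) :
    C.colDeg c {u} v q = if C.graph.Adj (v, q) (u, c u) then 1 else 0 := by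
  unfold colDeg
  rw [filter_singleton]
  split_ifs <;> simp

theorem not_adj_fibre (v : V) (p q : Fin κ) : ¬ C.graph.Adj (v, p) (v, q) :=
  fun h => (C.adj_fst _ _ h).ne rfl

theorem colDeg_erase_self (v : V) (q : Fin κ) : C.colDeg c (B.erase v) v q = C.colDeg c B v q := by
  unfold colDeg
  congr 1
  ext u
  simp only [mem_filter, mem_erase]
  refine ⟨fun h => ⟨h.1.2, h.2⟩, fun h => ⟨⟨?_, h.1⟩, h.2⟩⟩
  rintro rfl
  exact not_adj_fibre _ _ _ h.2

/-- By the matching property, a chosen vertex is adjacent to at most one vertex of the fibre over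
`v`, so every base neighbour is counted for at most one colour. -/
theorem sum_colDeg_le (C : ValuedCover G κ) (c : V → Fin κ) (B : Finset V) (v : V) :
    ∑ q, C.colDeg c B v q ≤ degIn G B v := by
  unfold colDeg degIn
  rw [← card_biUnion]
  · refine card_le_card fun u hu => ?_
    simp only [mem_biUnion, mem_filter, mem_univ, true_and] at hu ⊢
    obtain ⟨q, hu, hq⟩ := hu
    exact ⟨hu, C.adj_fst _ _ hq⟩
  · intro p _ q _ hpq
    rw [Function.onFun, disjoint_left]
    intro u hp hq
    simp only [mem_filter] at hp hq
    exact hpq (Prod.ext_iff.1 (C.matching _ _ _ hp.2.symm hq.2.symm rfl)).2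

theorem Degen.mono (h : C.Degen f c A) (hBA : B ⊆ A) : C.Degen f c B :=
  fun B' hB' hne => h B' (hB'.trans hBA) hne

theorem Degen.congr (h : C.Degen f c A) (hc : ∀ u ∈ A, c u = c' u) : C.Degen f c' A := by
  intro B hB hne
  obtain ⟨v, hv, hlt⟩ := h B hB hne
  refine ⟨v, hv, ?_⟩
  rwa [← hc v (hB hv), ← colDeg_congr fun u hu => hc u (hB hu)]

theorem Degen.congr_val {g : V × Fin κ → ℕ} (h : C.Degen f c A)
    (hg : ∀ u ∈ A, f (u, c u) ≤ g (u, c u)) : C.Degen g c A := by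
  intro B hB hne
  obtain ⟨v, hv, hlt⟩ := h B hB hne
  exact ⟨v, hv, hlt.trans_le (hg v (hB hv))⟩

theorem degen_empty : C.Degen f c ∅ := fun _ hB hne => absurd (subset_empty.1 hB) hne.ne_empty

theorem Degen.pos (h : C.Degen f c A) {v : V} (hv : v ∈ A) : 0 < f (v, c v) := by
  obtain ⟨u, hu, hlt⟩ := h {v} (by simpa using hv) (singleton_nonempty v)
  rw [mem_singleton] at hu
  subst hu
  omega

/-- If a test set meets `T`, a low vertex of its trace on `T` stays low, because the reduced values
have already paid for all chosen neighbours in `S`. -/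
theorem Degen.union (hST : Disjoint S T) (hS : C.Degen f c S) (hT : C.Degen (C.reduce f c S) c T) :
    C.Degen f c (S ∪ T) := by
  intro B hB hne
  by_cases hBT : (B ∩ T).Nonempty
  · obtain ⟨v, hv, hlt⟩ := hT _ inter_subset_right hBT
    refine ⟨v, (mem_inter.1 hv).1, ?_⟩
    have h1 : C.colDeg c B v (c v) ≤ C.colDeg c (S ∪ B ∩ T) v (c v) := by
      refine colDeg_mono (fun u hu => ?_) _ _
      rcases mem_union.1 (hB hu) with h | h
      · exact mem_union_left _ h
      · exact mem_union_right _ (mem_inter.2 ⟨hu, h⟩)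
    rw [colDeg_union (disjoint_of_subset_right inter_subset_right hST)] at h1
    unfold reduce at hlt
    dsimp only at hlt
    omega
  · refine hS B (fun u hu => ?_) hne
    exact (mem_union.1 (hB hu)).resolve_right fun h => hBT ⟨u, mem_inter.2 ⟨hu, h⟩⟩

/-- Choosing `(v, q)` last. -/
theorem Degen.insert_last {v : V} {q : Fin κ} (h : C.Degen f c B) (hv : v ∉ B)
    (hlt : C.colDeg c B v q < f (v, q)) : C.Degen f (Function.update c v q) (insert v B) := by
  have hcu : ∀ u ∈ B, c u = Function.update c v q u := fun u hu => by
    rw [Function.update_of_ne]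
    rintro rfl
    exact hv hu
  intro B' hB' hne
  by_cases hvB : v ∈ B'
  · refine ⟨v, hvB, ?_⟩
    rw [Function.update_self, ← colDeg_erase_self]
    refine lt_of_le_of_lt ?_ hlt
    rw [colDeg_congr hcu]
    exact colDeg_mono (fun u hu => (mem_insert.1 (hB' (mem_erase.1 hu).2)).resolve_left
      (mem_erase.1 hu).1) _ _
  · exact h.congr hcu B' (fun u hu => (mem_insert.1 (hB' hu)).resolve_left
      (fun e => hvB (e ▸ hu))) hne

/-- Greedy choice: a connected set can be treated in any order towards the omitted vertex `w`. -/
theorem exists_degen_erase (hA : Conn G A) (hf : ∀ v ∈ A, degIn G A v ≤ ∑ q, f (v, q)) {w : V}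
    (hw : w ∈ A) (c₀ : V → Fin κ) :
    ∃ c, (∀ v, v ∉ A.erase w → c v = c₀ v) ∧ C.Degen f c (A.erase w) := by
  suffices h : ∀ n, ∀ B ⊆ A.erase w, #B = n →
      ∃ c, (∀ v, v ∉ A.erase w → c v = c₀ v) ∧ C.Degen f c B from h _ _ Subset.rfl rfl
  intro n
  induction n with
  | zero =>
    intro B _ hB
    rw [card_eq_zero] at hB
    subst hB
    exact ⟨c₀, fun _ _ => rfl, degen_empty⟩
  | succ n ih =>
    intro B hB hcard
    have hBA : B ⊆ A := hB.trans (erase_subset _ _)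
    obtain ⟨u, hu, v, hv, hvB, huv⟩ := hA B hBA (card_pos.1 (by omega))
      (fun h => notMem_erase w A (hB (h ▸ hw)))
    obtain ⟨c, hc₀, hc⟩ := ih (B.erase u) ((erase_subset _ _).trans hB)
      (by rw [card_erase_of_mem hu]; omega)
    have hlt : degIn G B u < degIn G A u :=
      card_lt_card ⟨filter_subset_filter _ hBA, fun h =>
        hvB (mem_filter.1 (h (mem_filter.2 ⟨hv, huv⟩))).1⟩
    have hsum : ∑ q, C.colDeg c (B.erase u) u q < ∑ q, f (u, q) :=
      calc ∑ q, C.colDeg c (B.erase u) u q ≤ degIn G (B.erase u) u := sum_colDeg_le _ _ _ _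
        _ = degIn G B u := degIn_erase_self u
        _ < degIn G A u := hlt
        _ ≤ _ := hf u (hBA hu)
    obtain ⟨q, -, hq⟩ := exists_lt_of_sum_lt hsum
    refine ⟨Function.update c u q, fun z hz => ?_, ?_⟩
    · rw [Function.update_of_ne, hc₀ z hz]
      rintro rfl
      exact hz (hB hu)
    · have := hc.insert_last (notMem_erase u B) hq
      rwa [insert_erase hu] at this

theorem degIn_le_sum_reduce (hSA : S ⊆ A) {u : V} (hu : degIn G A u ≤ ∑ q, f (u, q)) :
    degIn G (A \ S) u ≤ ∑ q, C.reduce f c S (u, q) := by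
  have h1 := degIn_sdiff_add (G := G) hSA u
  have h2 := sum_colDeg_le C c S u
  have h3 : ∑ q, f (u, q) ≤ ∑ q, C.reduce f c S (u, q) + ∑ q, C.colDeg c S u q := by
    rw [← sum_add_distrib]
    exact sum_le_sum fun q _ => le_tsub_add
  omega

theorem reduce_congr (h : ∀ u ∈ S, c u = c' u) : C.reduce f c S = C.reduce f c' S := by
  funext x
  unfold reduce
  rw [colDeg_congr h]

theorem degen_singleton {v : V} (h : 0 < f (v, c v)) : C.Degen f c {v} := by
  intro B hB hne
  rw [hne.subset_singleton_iff.1 hB]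
  refine ⟨v, mem_singleton_self v, ?_⟩
  rwa [colDeg_singleton, if_neg (not_adj_fibre _ _ _)]

/-- A strictly degenerate choice over a part of a critical set reduces it to a critical set. -/
theorem Critical.reduce (h : C.Critical f A) (hSA : S ⊆ A) (hconn : Conn G (A \ S))
    (hc : C.Degen f c S) : C.Critical (C.reduce f c S) (A \ S) := by
  refine ⟨hconn, fun u hu => degIn_le_sum_reduce hSA (h.degIn_le u (mem_sdiff.1 hu).1), ?_⟩
  intro c' hc'
  let d : V → Fin κ := fun v => if v ∈ S then c v else c' v
  have hS : ∀ u ∈ S, c u = d u := fun u hu => by simp [d, hu]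
  have hT : ∀ u ∈ A \ S, c' u = d u := fun u hu => by simp [d, (mem_sdiff.1 hu).2]
  have := (hc.congr hS).union disjoint_sdiff (T := A \ S)
    (by rw [← reduce_congr hS]; exact hc'.congr hT)
  rw [union_sdiff_of_subset hSA] at this
  exact h.bad d this

/-- No colour can be appended over `w`, so each `f (w, q)` is at most the corresponding degree. The
degrees sum to at most the base degree, which is at most the sum of the values; hence equality holds
throughout. -/
theorem Critical.colDeg_eq (h : C.Critical f A) {w : V} (hw : w ∈ A)
    (hc : C.Degen f c (A.erase w)) :
    (∀ q, C.colDeg c (A.erase w) w q = f (w, q)) ∧ ∑ q, f (w, q) = degIn G A w := by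
  have hge : ∀ q, f (w, q) ≤ C.colDeg c (A.erase w) w q := by
    intro q
    by_contra hlt
    have := hc.insert_last (notMem_erase w A) (not_le.1 hlt)
    rw [insert_erase hw] at this
    exact h.bad _ this
  have h1 := sum_colDeg_le C c (A.erase w) w
  rw [degIn_erase_self] at h1
  have h2 := h.degIn_le w hw
  have h3 : ∑ q, f (w, q) ≤ ∑ q, C.colDeg c (A.erase w) w q := sum_le_sum fun q _ => hge q
  have h4 : ∑ q, f (w, q) = ∑ q, C.colDeg c (A.erase w) w q := by omega
  refine ⟨fun q => ?_, by omega⟩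
  exact ((sum_eq_sum_iff_of_le fun q _ => hge q).1 h4 q (mem_univ q)).symm

theorem Critical.sum_eq [NeZero κ] (h : C.Critical f A) {w : V} (hw : w ∈ A) :
    ∑ q, f (w, q) = degIn G A w := by
  obtain ⟨c, -, hc⟩ := exists_degen_erase (C := C) h.conn h.degIn_le hw (fun _ => 0)
  exact (h.colDeg_eq hw hc).2

/-- Both the original and the reduced set are critical, so their value sums are exactly the base
degrees. This leaves no room for truncation in `reduce`, nor for an edge between `u` and `S` that
fails to meet the choice. -/
theorem Critical.reduce_add [NeZero κ] (h : C.Critical f A) (hSA : S ⊆ A)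
    (hconn : Conn G (A \ S)) (hc : C.Degen f c S) {u : V} (hu : u ∈ A \ S) :
    (∀ q, C.reduce f c S (u, q) + C.colDeg c S u q = f (u, q)) ∧
      ∑ q, C.colDeg c S u q = degIn G S u := by
  have h1 := (h.reduce hSA hconn hc).sum_eq hu
  have h2 := h.sum_eq (mem_sdiff.1 hu).1
  have h3 := degIn_sdiff_add (G := G) hSA u
  have h4 := sum_colDeg_le C c S u
  have hle : ∀ q ∈ (univ : Finset (Fin κ)),
      f (u, q) ≤ C.reduce f c S (u, q) + C.colDeg c S u q := fun q _ => le_tsub_add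
  have h5 := sum_le_sum hle
  rw [sum_add_distrib] at h5
  have h6 : ∑ q, f (u, q) = ∑ q, (C.reduce f c S (u, q) + C.colDeg c S u q) := by
    rw [sum_add_distrib]
    omega
  exact ⟨fun q => ((sum_eq_sum_iff_of_le hle).1 h6 q (mem_univ q)).symm, by omega⟩

/-- Over a non-cut vertex `v`, a vertex of the kernel has a neighbour in the kernel in every
adjacent fibre. -/
theorem Critical.exists_adj [NeZero κ] (h : C.Critical f A) {v u : V} (hv : v ∈ A) (hu : u ∈ A)
    (hconn : Conn G (A.erase v)) (huv : G.Adj v u) {q : Fin κ} (hq : 0 < f (v, q)) :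
    ∃ p, C.graph.Adj (v, q) (u, p) ∧ 0 < f (u, p) := by
  have hcD : C.Degen f (fun _ => q) {v} := degen_singleton hq
  rw [← sdiff_singleton_eq_erase] at hconn
  obtain ⟨h1, h2⟩ := h.reduce_add (singleton_subset_iff.2 hv) hconn hcD
    (u := u) (by simp [hu, huv.ne'])
  have h3 : degIn G {v} u = 1 := by
    unfold degIn
    rw [filter_singleton, if_pos huv.symm, card_singleton]
  obtain ⟨p, -, hp⟩ := exists_ne_zero_of_sum_ne_zero (by omega : ∑ q', C.colDeg (fun _ => q) {v} u q' ≠ 0)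
  have := h1 p
  refine ⟨p, ?_, by omega⟩
  rw [colDeg_singleton] at hp
  exact (of_not_not fun hn => hp (if_neg hn)).symm

/-- The colour of a non-cut vertex can be prescribed. -/
theorem Critical.exists_degen_erase_of_pos (h : C.Critical f A) {v w : V} (hv : v ∈ A) (hw : w ∈ A)
    (hwv : w ≠ v) (hconn : Conn G (A.erase v)) {q : Fin κ} (hq : 0 < f (v, q)) :
    ∃ c, c v = q ∧ C.Degen f c (A.erase w) := by
  have hcD : C.Degen f (fun _ => q) {v} := degen_singleton hq
  obtain ⟨c, hc₀, hc⟩ := exists_degen_erase (C := C) (f := C.reduce f (fun _ => q) {v}) hconn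
    (fun u hu => by
      rw [← sdiff_singleton_eq_erase]
      exact degIn_le_sum_reduce (singleton_subset_iff.2 hv) (h.degIn_le u (mem_erase.1 hu).2))
    (mem_erase.2 ⟨hwv, hw⟩) (fun _ => q)
  have hcv : c v = q := hc₀ v (by simp)
  have hS : ∀ u ∈ ({v} : Finset V), q = c u := fun u hu => by rw [mem_singleton.1 hu, hcv]
  have hu := (hcD.congr hS).union (T := (A.erase v).erase w) (by simp)
    (by rw [← reduce_congr hS]; exact hc)
  refine ⟨c, hcv, ?_⟩
  rwa [erase_right_comm, ← insert_eq, insert_erase (mem_erase.2 ⟨hwv.symm, hv⟩)] at hu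

/-- The omitted vertex moves from `w` to `u`, and the chosen vertex over `u` to its neighbour
over `w`. -/
theorem Critical.degen_update (h : C.Critical f A) {w u : V} (hw : w ∈ A) (hu : u ∈ A)
    (huw : u ≠ w) (hc : C.Degen f c (A.erase w)) {r : Fin κ}
    (hr : C.graph.Adj (w, r) (u, c u)) : C.Degen f (Function.update c w r) (A.erase u) := by
  have h1 := (h.colDeg_eq hw hc).1 r
  have h2 : insert u ((A.erase w).erase u) = A.erase w := insert_erase (mem_erase.2 ⟨huw, hu⟩)
  rw [← h2, colDeg_insert (notMem_erase u _), if_pos hr] at h1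
  -- Dropping the vertex over `u` lowers the degree of `(w, r)` from `f (w, r)` to one less, so `(w,
  -- r)` can be chosen last.
  have h3 := (hc.mono (erase_subset u _)).insert_last (v := w) (q := r) (by simp) (by omega)
  rwa [erase_right_comm, insert_erase (mem_erase.2 ⟨huw.symm, hw⟩)] at h3

end ValuedCover

end Degenerate

/-! ### Critical sets without cut vertices: values along kernel edges -/

section Blocks

variable {V : Type u} {G : SimpleGraph V} {κ : ℕ} {A B S T : Finset V}

theorem le_one_of_sum_eq_two {g : Fin κ → ℕ} (hg : ∑ q, g q = 2) {p q : Fin κ} (hpq : p ≠ q)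
    (hp : 0 < g p) (hq : 0 < g q) (x : Fin κ) : g x ≤ 1 := by
  obtain ⟨y, hyx, hy⟩ : ∃ y, y ≠ x ∧ 0 < g y := by
    by_cases h : p = x
    · exact ⟨q, fun e => hpq (h.trans e.symm), hq⟩
    · exact ⟨p, h, hp⟩
  have h1 : ∑ z ∈ ({y, x} : Finset (Fin κ)), g z ≤ ∑ z, g z :=
    sum_le_sum_of_subset (subset_univ _)
  rw [sum_pair hyx] at h1
  omega

namespace ValuedCover

/-- Some fibre over `A` contains at least two vertices of the kernel. -/
def TwoColoured (f : V × Fin κ → ℕ) (A : Finset V) : Prop :=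
  ∃ v ∈ A, ∃ p q, p ≠ q ∧ 0 < f (v, p) ∧ 0 < f (v, q)

variable {C : ValuedCover G κ} {f : V × Fin κ → ℕ} {c c' : V → Fin κ}

theorem snd_eq_of_adj {x : V × Fin κ} {u : V} {p q : Fin κ} (h₁ : C.graph.Adj x (u, p))
    (h₂ : C.graph.Adj x (u, q)) : p = q :=
  (Prod.ext_iff.1 (C.matching _ _ _ h₁ h₂ rfl)).2

/-- Two kernel vertices in a fibre have kernel neighbours in each adjacent fibre, and these differ
by the matching property; connectedness spreads this over `A`. -/
theorem Critical.forall_two_colours [NeZero κ] (h : C.Critical f A) (hA : NoCut G A)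
    (h2 : TwoColoured f A) : ∀ v ∈ A, ∃ p q, p ≠ q ∧ 0 < f (v, p) ∧ 0 < f (v, q) := by
  obtain ⟨v₀, hv₀, h₀⟩ := h2
  let B : Finset V := {v ∈ A | ∃ p q, p ≠ q ∧ 0 < f (v, p) ∧ 0 < f (v, q)}
  by_cases hB : B = A
  · intro v hv
    have hvB : v ∈ B := hB.symm ▸ hv
    exact (mem_filter.1 hvB).2
  obtain ⟨u, hu, v, hv, hvB, huv⟩ := hA.conn B (filter_subset _ _) ⟨v₀, mem_filter.2 ⟨hv₀, h₀⟩⟩ hB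
  obtain ⟨huA, p, q, hpq, hp, hq⟩ := mem_filter.1 hu
  obtain ⟨p', hpp', hp'⟩ := h.exists_adj huA hv (hA.erase u huA) huv hp
  obtain ⟨q', hqq', hq'⟩ := h.exists_adj huA hv (hA.erase u huA) huv hq
  refine absurd (mem_filter.2 ⟨hv, p', q', ?_, hp', hq'⟩) hvB
  rintro rfl
  exact hpq (snd_eq_of_adj hpp'.symm hqq'.symm)

theorem Critical.exists_pos (h : C.Critical f A)
    (hcard : 2 ≤ #A) {v : V} (hv : v ∈ A) : ∃ q, 0 < f (v, q) := by
  obtain ⟨w, hw, hwv⟩ := exists_mem_ne (by omega : 1 < #A) v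
  obtain ⟨y, hy, -, hvy⟩ := h.conn.exists_adj hv hw hwv.symm
  have h1 : 0 < degIn G A v := card_pos.2 ⟨y, mem_filter.2 ⟨hy, hvy⟩⟩
  have h2 := h.degIn_le v hv
  obtain ⟨q, -, hq⟩ := exists_ne_zero_of_sum_ne_zero (by omega : ∑ q, f (v, q) ≠ 0)
  exact ⟨q, Nat.pos_of_ne_zero hq⟩

/-- In a critical set without cut vertices, the matchings over a triangle compose trivially. -/
theorem Critical.adj_of_triangle [NeZero κ] (h : C.Critical f A) (hA : NoCut G A) {w v₁ v₂ : V}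
    (hw : w ∈ A) (h₁ : v₁ ∈ A) (h₂ : v₂ ∈ A) (hw₁ : G.Adj w v₁) (hw₂ : G.Adj w v₂)
    {r s t : Fin κ} (hts : C.graph.Adj (v₂, t) (v₁, s)) (hsr : C.graph.Adj (v₁, s) (w, r))
    (ht : 0 < f (v₂, t)) : C.graph.Adj (v₂, t) (w, r) := by
  have h₁₂ : G.Adj v₂ v₁ := C.adj_fst _ _ hts
  obtain ⟨c, hct, hc⟩ := h.exists_degen_erase_of_pos h₂ hw hw₂.ne (hA.erase v₂ h₂) ht
  have hv₁w : v₁ ∈ A.erase w := mem_erase.2 ⟨hw₁.ne', h₁⟩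
  have hv₂w : v₂ ∈ (A.erase w).erase v₁ := mem_erase.2 ⟨h₁₂.ne, mem_erase.2 ⟨hw₂.ne', h₂⟩⟩
  obtain ⟨r₁, hr₁, hr₁pos⟩ := h.exists_adj h₁ hw (hA.erase v₁ h₁) hw₁.symm (hc.pos hv₁w)
  -- The gap moves from `w` to `v₁`, then to `v₂`, then back to `w`. Only the colours over `v₁` and
  -- `v₂` have changed, yet the degree of `(w, r)` must be `f (w, r)` before and after.
  have hc₁ := h.degen_update hw h₁ hw₁.ne' hc hr₁.symm
  set c₁ := Function.update c w r₁ with hc₁def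
  have hc₁v₂ : c₁ v₂ = t := by rw [hc₁def, Function.update_of_ne hw₂.ne', hct]
  have hc₂ := h.degen_update h₁ h₂ h₁₂.ne hc₁ (r := s) (by rw [hc₁v₂]; exact hts.symm)
  set c₂ := Function.update c₁ v₁ s with hc₂def
  have hc₂w : c₂ w = r₁ := by
    rw [hc₂def, Function.update_of_ne hw₁.ne, hc₁def, Function.update_self]
  obtain ⟨t', ht', -⟩ := h.exists_adj hw h₂ (hA.erase w hw) hw₂ hr₁pos
  have hc₃ := h.degen_update h₂ hw hw₂.ne hc₂ (r := t') (by rw [hc₂w]; exact ht'.symm)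
  set c₃ := Function.update c₂ v₂ t' with hc₃def
  have e₁ := (h.colDeg_eq hw hc).1 r
  have e₂ := (h.colDeg_eq hw hc₃).1 r
  have hcongr : C.colDeg c₃ (((A.erase w).erase v₁).erase v₂) w r =
      C.colDeg c (((A.erase w).erase v₁).erase v₂) w r := by
    refine colDeg_congr (fun u hu => ?_) _ _
    simp only [mem_erase] at hu
    rw [hc₃def, Function.update_of_ne hu.1, hc₂def, Function.update_of_ne hu.2.1, hc₁def,
      Function.update_of_ne hu.2.2.1]
  have hc₃v₁ : c₃ v₁ = s := by
    rw [hc₃def, Function.update_of_ne h₁₂.ne', hc₂def, Function.update_self]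
  have hc₃v₂ : c₃ v₂ = t' := by rw [hc₃def, Function.update_self]
  rw [← insert_erase hv₁w, colDeg_insert (notMem_erase _ _), ← insert_erase hv₂w,
    colDeg_insert (notMem_erase _ _)] at e₁ e₂
  rw [hcongr, hc₃v₁, hc₃v₂, if_pos hsr.symm] at e₂
  rw [hct] at e₁
  by_contra hcon
  rw [if_neg (fun h => hcon h.symm) (c := C.graph.Adj (w, r) (v₂, t))] at e₁
  -- Afterwards `(v₁, s)` contributes 1. Without the edge from `(v₂, t)`, the initial contribution
  -- can only come from `v₁`; then `r = r₁`, so `(v₂, t')` contributes as well and the final count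
  -- is 2 against 1.
  by_cases hr : C.graph.Adj (w, r) (v₁, c v₁)
  · have := snd_eq_of_adj hr.symm hr₁
    subst this
    rw [if_pos hr] at e₁
    rw [if_pos ht'] at e₂
    omega
  · rw [if_neg hr] at e₁
    omega

/-- Over a complete graph the values are constant along the edges of the kernel. -/
theorem Critical.eq_of_adj_of_complete [NeZero κ] (h : C.Critical f A) (hA : NoCut G A)
    (hcomp : ∀ u ∈ A, ∀ v ∈ A, u ≠ v → G.Adj u v) {u w : V} (hu : u ∈ A) (hw : w ∈ A)
    {p r : Fin κ} (hadj : C.graph.Adj (u, p) (w, r)) (hp : 0 < f (u, p)) :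
    f (u, p) = f (w, r) := by
  have huw : G.Adj u w := C.adj_fst _ _ hadj
  obtain ⟨c, hcp, hc⟩ := h.exists_degen_erase_of_pos hu hw huw.ne' (hA.erase u hu) hp
  have huA : u ∈ A.erase w := mem_erase.2 ⟨huw.ne, hu⟩
  have hwA : w ∈ A.erase u := mem_erase.2 ⟨huw.ne', hw⟩
  have hc' := h.degen_update hw hu huw.ne hc (r := r) (by rw [hcp]; exact hadj.symm)
  have e₁ := (h.colDeg_eq hw hc).1 r
  have e₂ := (h.colDeg_eq hu hc').1 p
  rw [← insert_erase huA, colDeg_insert (notMem_erase _ _), hcp, if_pos hadj.symm] at e₁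
  rw [← insert_erase hwA, colDeg_insert (notMem_erase _ _), Function.update_self, if_pos hadj,
    erase_right_comm] at e₂
  -- By the triangle property, `(u, p)` and `(w, r)` have the same neighbours among the other chosen
  -- vertices; each value is one more than this common number.
  have key : C.colDeg (Function.update c w r) ((A.erase w).erase u) u p =
      C.colDeg c ((A.erase w).erase u) w r := by
    unfold colDeg
    congr 1
    refine filter_congr fun x hx => ?_
    simp only [mem_erase] at hx
    obtain ⟨hxu, hxw, hx⟩ := hx
    rw [Function.update_of_ne hxw]
    have hpos := hc.pos (mem_erase.2 ⟨hxw, hx⟩)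
    constructor
    · intro hux
      exact (h.adj_of_triangle hA hw hu hx huw.symm (hcomp w hw x hx hxw.symm) hux.symm hadj
        hpos).symm
    · intro hwx
      exact (h.adj_of_triangle hA hu hw hx huw (hcomp u hu x hx hxu.symm) hwx.symm hadj.symm
        hpos).symm
  omega

theorem colDeg_eq_zero {v : V} {q : Fin κ} (h : ∀ z ∈ S, ¬ G.Adj v z) : C.colDeg c S v q = 0 := by
  unfold colDeg
  rw [card_eq_zero, filter_eq_empty_iff]
  exact fun z hz hadj => h z hz (C.adj_fst _ _ hadj)

theorem colDeg_eq_ite {a v : V} {q : Fin κ} (hv : v ∈ S) (h : ∀ z ∈ S, G.Adj a z → z = v) :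
    C.colDeg c S a q = if C.graph.Adj (a, q) (v, c v) then 1 else 0 := by
  rw [← insert_erase hv, colDeg_insert (notMem_erase _ _), colDeg_eq_zero, add_zero]
  intro z hz haz
  exact (mem_erase.1 hz).1 (h z (mem_erase.1 hz).2 haz)

/-- In a critical set without cut vertices in which some fibre has two kernel vertices,
the values are constant along the edges of the kernel, and there is no reduction. -/
theorem Critical.eq_of_adj [NeZero κ] (h : C.Critical f A) (hA : NoCut G A) (hcard : 2 ≤ #A)
    (h2 : TwoColoured f A) :
    (∀ S v a d, ¬ IsReduction G A S v a d) ∧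
      ∀ u ∈ A, ∀ w ∈ A, ∀ p r, C.graph.Adj (u, p) (w, r) → 0 < f (u, p) → f (u, p) = f (w, r) := by
  induction hn : #A using Nat.strong_induction_on generalizing A f with
  | _ n ih =>
  subst hn
  have hall := h.forall_two_colours hA h2
  have hnored : ∀ S v a d, ¬ IsReduction G A S v a d := by
    intro S v a d hred
    have hvA := hred.subset hred.mem
    obtain ⟨haA, haS⟩ := mem_sdiff.1 hred.left_mem
    obtain ⟨hdA, hdS⟩ := mem_sdiff.1 hred.right_mem
    obtain ⟨t₁, t₂, ht, ht₁, ht₂⟩ := hall v hvA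
    obtain ⟨s, hts, hs⟩ := h.exists_adj hvA haA (hA.erase v hvA) hred.adj_mem.symm ht₁
    obtain ⟨r, hsr, hr⟩ := h.exists_adj haA hdA (hA.erase a haA) hred.adj hs
    obtain ⟨p, q, hpq, hp, hq⟩ := hall d hdA
    have hcardS : #(A \ S) < #A := by
      rw [card_sdiff_of_subset hred.subset]
      have := card_pos.2 ⟨v, hred.mem⟩
      omega
    have hcard2 : 2 ≤ #(A \ S) :=
      one_lt_card.2 ⟨a, hred.left_mem, d, hred.right_mem, hred.adj.ne⟩
    have hav : a ≠ v := hred.adj_mem.ne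
    -- Colour `S` with `t` over `v` and apply induction to the remainder. The fibre of `d` is
    -- untouched and so still has two kernel vertices, while `(a, s)` loses 1 exactly if it is
    -- matched to `(v, t)`.
    have key : ∀ t, 0 < f (v, t) →
        f (d, r) = f (a, s) - if C.graph.Adj (a, s) (v, t) then 1 else 0 := by
      intro t htpos
      obtain ⟨c, hcv, hc⟩ := h.exists_degen_erase_of_pos hvA haA hav (hA.erase v hvA) htpos
      have hcS : C.Degen f c S :=
        hc.mono fun z hz => mem_erase.2 ⟨fun e => haS (e ▸ hz), hred.subset hz⟩
      have hd : ∀ q, C.reduce f c S (d, q) = f (d, q) := by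
        intro q
        unfold ValuedCover.reduce
        rw [colDeg_eq_zero hred.not_adj, tsub_zero]
      have ha : C.reduce f c S (a, s) =
          f (a, s) - if C.graph.Adj (a, s) (v, t) then 1 else 0 := by
        unfold ValuedCover.reduce
        rw [colDeg_eq_ite hred.mem hred.unique, hcv]
      rw [← hd r, ← ha]
      refine (ih _ hcardS (h.reduce hred.subset hred.noCut.conn hcS) hred.noCut hcard2
        ⟨d, hred.right_mem, p, q, hpq, ?_, ?_⟩ rfl).2 d hred.right_mem a hred.left_mem r s hsr.symm ?_
      · rwa [hd]
      · rwa [hd]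
      · rwa [hd]
    have k₁ := key t₁ ht₁
    have k₂ := key t₂ ht₂
    rw [if_pos hts.symm] at k₁
    rw [if_neg (fun hadj => ht (snd_eq_of_adj hts.symm hadj))] at k₂
    -- The colours `t₁` and `t₂` give `f (d, r)` the values `f (a, s) - 1` and `f (a, s)`, and `f
    -- (a, s)` is positive.
    omega
  refine ⟨hnored, fun u hu w hw p r hadj hp => ?_⟩
  rcases hA.exists_reduction hcard with hcomp | hreg | ⟨S, v, a, d, hred⟩
  · exact h.eq_of_adj_of_complete hA hcomp hu hw hadj hp
  · have hone : ∀ v ∈ A, ∀ q, f (v, q) ≤ 1 := by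
      intro v hv q
      obtain ⟨p', q', hpq', hp', hq'⟩ := hall v hv
      exact le_one_of_sum_eq_two (g := fun q => f (v, q)) ((h.sum_eq hv).trans (hreg v hv)) hpq'
        hp' hq' q
    have huw : G.Adj u w := C.adj_fst _ _ hadj
    obtain ⟨r', hr', hpos⟩ := h.exists_adj hu hw (hA.erase u hu) huw hp
    have := snd_eq_of_adj hadj hr'
    subst this
    have h1 := hone u hu p
    have h2 := hone w hw r
    omega
  · exact absurd hred (hnored _ _ _ _)

end ValuedCover

end Blocks

/-! ### Splitting a critical cover at a cut vertex -/

section CutVertex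

variable {V : Type u} {G : SimpleGraph V} {κ : ℕ} {A A₁ A₂ B S T : Finset V}

theorem Conn.left_of_union (h : Conn G (A₁ ∪ A₂)) {w : V} (hw : A₁ ∩ A₂ = {w})
    (hsep : ∀ u ∈ A₁, ∀ v ∈ A₂, u ≠ w → v ≠ w → ¬ G.Adj u v) : Conn G A₁ := by
  have hw' : w ∈ A₁ ∧ w ∈ A₂ := mem_inter.1 (hw ▸ mem_singleton_self w)
  refine Conn.of_root hw'.1 fun B hB hne hwB => ?_
  obtain ⟨u, hu, v, hv, hvB, huv⟩ := h B (hB.trans subset_union_left) hne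
    (fun e => hwB (e ▸ mem_union_left _ hw'.1))
  refine ⟨u, hu, v, ?_, hvB, huv⟩
  by_contra hvA
  have hvA₂ := (mem_union.1 hv).resolve_left hvA
  refine hsep u (hB hu) v hvA₂ ?_ ?_ huv
  · rintro rfl
    exact hwB hu
  · rintro rfl
    exact hvA hw'.1

namespace ValuedCover

/-- The function `f` with its values over `w` replaced by `g`. -/
noncomputable def replaceAt (f : V × Fin κ → ℕ) (w : V) (g : Fin κ → ℕ) : V × Fin κ → ℕ :=
  fun x => if x.1 = w then g x.2 else f x

variable {C : ValuedCover G κ} {f : V × Fin κ → ℕ} {c c' : V → Fin κ}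

theorem replaceAt_self (w : V) (g : Fin κ → ℕ) (q : Fin κ) : replaceAt f w g (w, q) = g q :=
  if_pos rfl

theorem replaceAt_of_ne {w v : V} (h : v ≠ w) (g : Fin κ → ℕ) (q : Fin κ) :
    replaceAt f w g (v, q) = f (v, q) := if_neg h

/-- The largest values over `w` for which a connected set has no strictly degenerate choice. -/
theorem exists_largest_bad [NeZero κ] (hA : Conn G A) {w : V} (hw : w ∈ A)
    (hf : ∀ v ∈ A, v ≠ w → degIn G A v ≤ ∑ q, f (v, q)) :
    ∃ g : Fin κ → ℕ, (∀ c, ¬ C.Degen (replaceAt f w g) c A) ∧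
      ∀ q, ∃ c, c w = q ∧ C.Degen (replaceAt f w fun _ => g q + 1) c A := by
  -- Only the value at the selected colour `q` matters when `c w = q`, so a constant `t` may be put
  -- on the whole fibre. The least good `t` is positive, and one less than it is the required value.
  let P : Fin κ → ℕ → Prop := fun q t => ∃ c, c w = q ∧ C.Degen (replaceAt f w fun _ => t) c A
  have hP : ∀ q, ∃ t, P q t := by
    intro q
    obtain ⟨c, -, hc⟩ := exists_degen_erase (C := C) (f := replaceAt f w fun _ => degIn G A w) hA
      (fun v hv => by
        by_cases hvw : v = w
        · subst hvw
          simp only [replaceAt_self]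
          exact single_le_sum (f := fun _ : Fin κ => degIn G A v) (fun _ _ => Nat.zero_le _)
            (mem_univ q)
        · simp only [replaceAt_of_ne hvw]
          exact hf v hv hvw) hw (fun _ => 0)
    refine ⟨C.colDeg c (A.erase w) w q + 1, Function.update c w q, Function.update_self .., ?_⟩
    have hc' : C.Degen (replaceAt f w fun _ => C.colDeg c (A.erase w) w q + 1) c (A.erase w) :=
      hc.congr_val fun u hu => by
        rw [replaceAt_of_ne (mem_erase.1 hu).1, replaceAt_of_ne (mem_erase.1 hu).1]
    have := hc'.insert_last (notMem_erase w A) (q := q) (by rw [replaceAt_self]; omega)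
    rwa [insert_erase hw] at this
  have hpos : ∀ q, Nat.find (hP q) ≠ 0 := by
    intro q h0
    obtain ⟨c, -, hc⟩ := Nat.find_spec (hP q)
    have := hc.pos hw
    rw [replaceAt_self] at this
    omega
  refine ⟨fun q => Nat.find (hP q) - 1, fun c hc => ?_, fun q => ?_⟩
  · refine Nat.find_min (hP (c w)) (m := Nat.find (hP (c w)) - 1) ?_ ⟨c, rfl, ?_⟩
    · have := hpos (c w)
      omega
    · refine hc.congr_val fun u _ => ?_
      by_cases huw : u = w
      · subst huw
        rw [replaceAt_self, replaceAt_self]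
      · rw [replaceAt_of_ne huw, replaceAt_of_ne huw]
  · have := hpos q
    rw [show Nat.find (hP q) - 1 + 1 = Nat.find (hP q) by omega]
    exact Nat.find_spec (hP q)

/-- Two strictly degenerate choices over sets with a common vertex `w` can be combined. -/
theorem Degen.glue {c₁ c₂ : V → Fin κ} {w : V} {q : Fin κ} (hw : A₁ ∩ A₂ = {w})
    (hsep : ∀ u ∈ A₁, ∀ v ∈ A₂, u ≠ w → v ≠ w → ¬ G.Adj u v) {t₁ t₂ : ℕ}
    (h₁ : C.Degen (replaceAt f w fun _ => t₁ + 1) c₁ A₁) (hc₁ : c₁ w = q)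
    (h₂ : C.Degen (replaceAt f w fun _ => t₂ + 1) c₂ A₂) (hc₂ : c₂ w = q)
    (hlt : t₁ + t₂ < f (w, q)) : ∃ c, C.Degen f c (A₁ ∪ A₂) := by
  have hwmem : w ∈ A₁ ∧ w ∈ A₂ := mem_inter.1 (hw ▸ mem_singleton_self w)
  let d : V → Fin κ := fun v => if v ∈ A₁ then c₁ v else c₂ v
  have hd₁ : ∀ v ∈ A₁, c₁ v = d v := fun v hv => (if_pos hv).symm
  have hd₂ : ∀ v ∈ A₂, c₂ v = d v := by
    intro v hv
    by_cases hv₁ : v ∈ A₁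
    · have : v = w := mem_singleton.1 (hw ▸ mem_inter.2 ⟨hv₁, hv⟩)
      rw [← hd₁ v hv₁, this, hc₁, hc₂]
    · exact (if_neg hv₁).symm
  have hdw : d w = q := by rw [← hd₁ w hwmem.1, hc₁]
  refine ⟨d, fun B hB hne => ?_⟩
  -- Each side supplies either a low vertex other than `w`, whose neighbours in `B` all lie on that
  -- side, or a degree bound at `w`. If both sides point to `w`, the two bounds add up.
  have side : ∀ (A' A'' : Finset V) (t : ℕ), A₁ ∪ A₂ ⊆ A' ∪ A'' → w ∈ A' →
      (∀ u ∈ A', ∀ v ∈ A'', u ≠ w → v ≠ w → ¬ G.Adj u v) →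
      C.Degen (replaceAt f w fun _ => t + 1) d A' → (B ∩ A').Nonempty →
      (∃ v ∈ B, C.colDeg d B v (d v) < f (v, d v)) ∨ w ∈ B ∧ C.colDeg d (B ∩ A') w q ≤ t := by
    intro A' A'' t hsub hwA' hsep' hdeg hBne
    obtain ⟨v, hv, hlt'⟩ := hdeg _ inter_subset_right hBne
    rw [mem_inter] at hv
    by_cases hvw : v = w
    · subst hvw
      rw [replaceAt_self, hdw] at hlt'
      exact Or.inr ⟨hv.1, by omega⟩
    · rw [replaceAt_of_ne hvw] at hlt'
      refine Or.inl ⟨v, hv.1, ?_⟩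
      have : C.colDeg d B v (d v) = C.colDeg d (B ∩ A') v (d v) := by
        unfold colDeg
        congr 1
        ext u
        simp only [mem_filter, mem_inter]
        refine ⟨fun h => ⟨⟨h.1, ?_⟩, h.2⟩, fun h => ⟨h.1.1, h.2⟩⟩
        by_contra huA'
        have huA'' := (mem_union.1 (hsub (hB h.1))).resolve_left huA'
        exact hsep' v hv.2 u huA'' hvw (fun e => huA' (e ▸ hwA')) (C.adj_fst _ _ h.2)
      rwa [this]
  have s₁ := side A₁ A₂ t₁ Subset.rfl hwmem.1 hsep (h₁.congr hd₁)
  have s₂ := side A₂ A₁ t₂ (union_comm A₁ A₂).subset hwmem.2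
    (fun u hu v hv huw hvw h => hsep v hv u hu hvw huw h.symm) (h₂.congr hd₂)
  by_cases hwB : w ∈ B
  · rcases s₁ ⟨w, mem_inter.2 ⟨hwB, hwmem.1⟩⟩ with h | ⟨-, h₁'⟩
    · exact h
    rcases s₂ ⟨w, mem_inter.2 ⟨hwB, hwmem.2⟩⟩ with h | ⟨-, h₂'⟩
    · exact h
    refine ⟨w, hwB, ?_⟩
    rw [hdw]
    have hBsub : B.erase w ⊆ (B.erase w ∩ A₁) ∪ (B.erase w ∩ A₂) := by
      intro u hu
      rw [← inter_union_distrib_left]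
      exact mem_inter.2 ⟨hu, hB (mem_erase.1 hu).2⟩
    have hdisj : Disjoint (B.erase w ∩ A₁) (B.erase w ∩ A₂) := by
      rw [disjoint_left]
      intro u hu hu'
      simp only [mem_inter, mem_erase] at hu hu'
      exact hu.1.1 (mem_singleton.1 (hw ▸ mem_inter.2 ⟨hu.2, hu'.2⟩))
    have e := colDeg_mono (C := C) (c := d) hBsub w q
    rw [colDeg_union hdisj, colDeg_erase_self] at e
    have e₁ := colDeg_mono (C := C) (c := d)
      (inter_subset_inter (erase_subset w B) (Subset.refl A₁)) w q
    have e₂ := colDeg_mono (C := C) (c := d)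
      (inter_subset_inter (erase_subset w B) (Subset.refl A₂)) w q
    omega
  · obtain ⟨u, hu⟩ := hne
    rcases mem_union.1 (hB hu) with hu' | hu'
    · exact (s₁ ⟨u, mem_inter.2 ⟨hu, hu'⟩⟩).resolve_right fun h => hwB h.1
    · exact (s₂ ⟨u, mem_inter.2 ⟨hu, hu'⟩⟩).resolve_right fun h => hwB h.1

/-- At a cut vertex a critical set splits into two critical sets. -/
theorem Critical.split [NeZero κ] {w : V} (h : C.Critical f (A₁ ∪ A₂)) (hw : A₁ ∩ A₂ = {w})
    (hsep : ∀ u ∈ A₁, ∀ v ∈ A₂, u ≠ w → v ≠ w → ¬ G.Adj u v) :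
    ∃ g₁ g₂ : Fin κ → ℕ, (∀ q, f (w, q) = g₁ q + g₂ q) ∧
      C.Critical (replaceAt f w g₁) A₁ ∧ C.Critical (replaceAt f w g₂) A₂ := by
  have hwmem : w ∈ A₁ ∧ w ∈ A₂ := mem_inter.1 (hw ▸ mem_singleton_self w)
  have hsep' : ∀ u ∈ A₂, ∀ v ∈ A₁, u ≠ w → v ≠ w → ¬ G.Adj u v :=
    fun u hu v hv huw hvw h => hsep v hv u hu hvw huw h.symm
  have hconn₁ : Conn G A₁ := h.conn.left_of_union hw hsep
  have hconn₂ : Conn G A₂ := by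
    rw [union_comm] at h
    rw [inter_comm] at hw
    exact h.conn.left_of_union hw hsep'
  have hf₁ : ∀ v ∈ A₁, degIn G A₁ v ≤ ∑ q, f (v, q) := fun v hv =>
    (degIn_mono subset_union_left v).trans (h.degIn_le v (mem_union_left _ hv))
  have hf₂ : ∀ v ∈ A₂, degIn G A₂ v ≤ ∑ q, f (v, q) := fun v hv =>
    (degIn_mono subset_union_right v).trans (h.degIn_le v (mem_union_right _ hv))
  obtain ⟨g₁, hbad₁, hg₁⟩ := exists_largest_bad (C := C) hconn₁ hwmem.1 fun v hv _ => hf₁ v hv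
  obtain ⟨g₂, hbad₂, hg₂⟩ := exists_largest_bad (C := C) hconn₂ hwmem.2 fun v hv _ => hf₂ v hv
  have hle : ∀ q ∈ (univ : Finset (Fin κ)), f (w, q) ≤ g₁ q + g₂ q := by
    intro q _
    by_contra hlt
    obtain ⟨c₁, hc₁, h₁⟩ := hg₁ q
    obtain ⟨c₂, hc₂, h₂⟩ := hg₂ q
    obtain ⟨c, hc⟩ := Degen.glue hw hsep h₁ hc₁ h₂ hc₂ (not_le.1 hlt)
    exact h.bad c hc
  have hcrit : ∀ (A' : Finset V) (g : Fin κ → ℕ), Conn G A' →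
      (∀ v ∈ A', degIn G A' v ≤ ∑ q, f (v, q)) → (∀ c, ¬ C.Degen (replaceAt f w g) c A') →
      degIn G A' w ≤ ∑ q, g q → C.Critical (replaceAt f w g) A' := by
    intro A' g hc hf hb hd
    refine ⟨hc, fun v hv => ?_, hb⟩
    by_cases hvw : v = w
    · subst hvw
      simpa only [replaceAt_self] using hd
    · simpa only [replaceAt_of_ne hvw] using hf v hv
  -- A larger sum would make the side critical, and criticality forces the sum to equal the degree.
  have hsum : ∀ (A' : Finset V) (g : Fin κ → ℕ), w ∈ A' → Conn G A' →
      (∀ v ∈ A', degIn G A' v ≤ ∑ q, f (v, q)) → (∀ c, ¬ C.Degen (replaceAt f w g) c A') →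
      ∑ q, g q ≤ degIn G A' w := by
    intro A' g hwA' hc hf hb
    by_contra hlt
    have := (hcrit A' g hc hf hb (not_le.1 hlt).le).sum_eq hwA'
    simp only [replaceAt_self] at this
    omega
  have hs₁ := hsum A₁ g₁ hwmem.1 hconn₁ hf₁ hbad₁
  have hs₂ := hsum A₂ g₂ hwmem.2 hconn₂ hf₂ hbad₂
  have hdeg : degIn G (A₁ ∪ A₂) w = degIn G A₁ w + degIn G A₂ w := by
    rw [← degIn_erase_self, erase_union_distrib, degIn_union, degIn_erase_self, degIn_erase_self]
    rw [disjoint_left]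
    intro u hu hu'
    rw [mem_erase] at hu hu'
    exact hu.1 (mem_singleton.1 (hw ▸ mem_inter.2 ⟨hu.2, hu'.2⟩))
  have htot := h.sum_eq (mem_union_left _ hwmem.1)
  have hle' := sum_le_sum hle
  rw [sum_add_distrib] at hle'
  -- The sum of `f` at `w` is the total degree, which is at least the sums of `g₁` and `g₂`
  -- together, which are at least the sum of `f`: all inequalities are equalities.
  have heq : ∑ q, f (w, q) = ∑ q, (g₁ q + g₂ q) := by
    rw [sum_add_distrib]
    omega
  exact ⟨g₁, g₂, fun q => (sum_eq_sum_iff_of_le hle).1 heq q (mem_univ q),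
    hcrit A₁ g₁ hconn₁ hf₁ hbad₁ (by omega), hcrit A₂ g₂ hconn₂ hf₂ hbad₂ (by omega)⟩

/-- The part of a cover over a vertex set `A`, with the values of `f`. -/
def restrict (C : ValuedCover G κ) (f : V × Fin κ → ℕ) (A : Finset V) :
    ValuedCover (G.comap (Subtype.val : {v // v ∈ A} → V)) κ where
  graph := C.graph.comap fun x => (x.1.1, x.2)
  val x := f (x.1.1, x.2)
  adj_fst _ _ h := C.adj_fst _ _ h
  matching x y z hxy hxz hyz := by
    have := C.matching _ _ _ hxy hxz (congrArg Subtype.val hyz)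
    exact Prod.ext hyz (Prod.ext_iff.1 this).2

theorem degIn_comap (B : Finset {v // v ∈ A}) (v : {v // v ∈ A}) :
    degIn (G.comap (Subtype.val : {v // v ∈ A} → V)) B v =
      degIn G (B.map (Function.Embedding.subtype _)) v := by
  unfold degIn
  rw [filter_map, card_map]
  rfl

theorem colDeg_restrict (d : {v // v ∈ A} → Fin κ) (hd : ∀ v : {v // v ∈ A}, d v = c v)
    (B : Finset {v // v ∈ A}) (v : {v // v ∈ A}) (q : Fin κ) :
    (C.restrict f A).colDeg d B v q =
      C.colDeg c (B.map (Function.Embedding.subtype _)) v q := by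
  unfold colDeg
  rw [filter_map, card_map]
  congr 1
  refine filter_congr fun u _ => ?_
  rw [hd]
  rfl

theorem Critical.restrict [NeZero κ] (h : C.Critical f A) :
    (C.restrict f A).Critical (C.restrict f A).val univ := by
  have hmap : (univ : Finset {v // v ∈ A}).map (Function.Embedding.subtype _) = A := by
    ext v
    simp
  refine ⟨fun B _ hne hBu => ?_, fun v _ => ?_, fun d hd => ?_⟩
  · obtain ⟨u, hu, v, hv, hvB, huv⟩ := h.conn (B.map (Function.Embedding.subtype _))
      (fun u hu => by
        obtain ⟨x, -, rfl⟩ := mem_map.1 hu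
        exact x.2) (hne.map)
      (fun e => hBu (map_injective (Function.Embedding.subtype _) (e.trans hmap.symm)))
    obtain ⟨x, hx, rfl⟩ := mem_map.1 hu
    exact ⟨x, hx, ⟨v, hv⟩, mem_univ _, fun hvB' => hvB (mem_map.2 ⟨_, hvB', rfl⟩), huv⟩
  · rw [degIn_comap, hmap]
    exact h.degIn_le v v.2
  · let c : V → Fin κ := fun v => if hv : v ∈ A then d ⟨v, hv⟩ else 0
    have hc : ∀ v : {v // v ∈ A}, d v = c v := fun v => by simp [c]
    refine h.bad c fun B hB hne => ?_
    have hBmap : (B.subtype (· ∈ A)).map (Function.Embedding.subtype _) = B :=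
      subtype_map_of_mem fun v hv => hB hv
    obtain ⟨v, hv, hlt⟩ := hd (B.subtype (· ∈ A)) (subset_univ _) (by
      obtain ⟨x, hx⟩ := hne
      exact ⟨⟨x, hB hx⟩, mem_subtype.2 hx⟩)
    refine ⟨v, mem_subtype.1 hv, ?_⟩
    rw [colDeg_restrict d hc, hBmap, hc] at hlt
    exact hlt

/-- A cover is a gluing of its restrictions to two vertex sets that meet in a cut vertex. -/
theorem isGluing_restrict [Fintype V] {w : V} (hA : A₁ ∪ A₂ = univ) (hw : A₁ ∩ A₂ = {w})
    (hw₁ : w ∈ A₁) (hw₂ : w ∈ A₂)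
    (hsep : ∀ u ∈ A₁, ∀ v ∈ A₂, u ≠ w → v ≠ w → ¬ G.Adj u v) {g₁ g₂ : Fin κ → ℕ}
    (hg : ∀ q, C.val (w, q) = g₁ q + g₂ q) :
    C.IsGluing (C.restrict (replaceAt C.val w g₁) A₁) (C.restrict (replaceAt C.val w g₂) A₂)
      (Function.Embedding.subtype _) (Function.Embedding.subtype _) ⟨w, hw₁⟩ ⟨w, hw₂⟩ := by
  have hmem : ∀ v, v ∈ A₁ ∨ v ∈ A₂ := fun v => mem_union.1 (hA ▸ mem_univ v)
  have hedge : ∀ u v, G.Adj u v → (u ∈ A₁ ∧ v ∈ A₁) ∨ (u ∈ A₂ ∧ v ∈ A₂) := by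
    intro u v huv
    by_cases huw : u = w
    · subst huw
      exact (hmem v).imp (fun h => ⟨hw₁, h⟩) (fun h => ⟨hw₂, h⟩)
    by_cases hvw : v = w
    · subst hvw
      exact (hmem u).imp (fun h => ⟨h, hw₁⟩) (fun h => ⟨h, hw₂⟩)
    rcases hmem u with hu | hu <;> rcases hmem v with hv | hv
    · exact Or.inl ⟨hu, hv⟩
    · exact absurd huv (hsep u hu v hv huw hvw)
    · exact absurd huv.symm (hsep v hv u hu hvw huw)
    · exact Or.inr ⟨hu, hv⟩
  refine ⟨fun v => ?_, ?_, fun u v => ?_, fun u p v q => ?_, fun q => ?_, ?_, ?_⟩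
  · exact (hmem v).imp (fun h => ⟨⟨v, h⟩, rfl⟩) (fun h => ⟨⟨v, h⟩, rfl⟩)
  · rintro ⟨a, ha⟩ ⟨b, hb⟩
    simp only [Function.Embedding.subtype_apply, Subtype.mk.injEq]
    constructor
    · rintro rfl
      have := mem_singleton.1 (hw ▸ mem_inter.2 ⟨ha, hb⟩)
      exact ⟨this, this⟩
    · rintro ⟨rfl, rfl⟩
      rfl
  · constructor
    · intro huv
      exact (hedge u v huv).imp (fun h => ⟨⟨u, h.1⟩, ⟨v, h.2⟩, rfl, rfl, huv⟩)
        (fun h => ⟨⟨u, h.1⟩, ⟨v, h.2⟩, rfl, rfl, huv⟩)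
    · rintro (⟨a, a', rfl, rfl, h⟩ | ⟨a, a', rfl, rfl, h⟩) <;> exact h
  · constructor
    · intro huv
      exact (hedge u v (C.adj_fst _ _ huv)).imp (fun h => ⟨⟨u, h.1⟩, ⟨v, h.2⟩, rfl, rfl, huv⟩)
        (fun h => ⟨⟨u, h.1⟩, ⟨v, h.2⟩, rfl, rfl, huv⟩)
    · rintro (⟨a, a', rfl, rfl, h⟩ | ⟨a, a', rfl, rfl, h⟩) <;> exact h
  · change C.val (w, q) = replaceAt C.val w g₁ (w, q) + replaceAt C.val w g₂ (w, q)
    rw [replaceAt_self, replaceAt_self, hg]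
  · intro a q ha
    exact (replaceAt_of_ne (fun e => ha (Subtype.ext e)) _ _).symm
  · intro a q ha
    exact (replaceAt_of_ne (fun e => ha (Subtype.ext e)) _ _).symm

end ValuedCover

end CutVertex

/-! ### Recognizing cycles, monoblocks and complete building covers -/

section Building

variable {V : Type u} [Fintype V] {G : SimpleGraph V} {κ : ℕ}

theorem degIn_univ (v : V) : degIn G univ v = G.degree v := by
  unfold degIn
  rw [← SimpleGraph.card_neighborFinset_eq_degree, SimpleGraph.neighborFinset_eq_filter]

theorem vdeg_eq_degIn (v : V) : vdeg G v = degIn G univ v := by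
  unfold vdeg degIn
  rw [← Set.ncard_coe_finset]
  congr 1
  ext u
  simp

theorem Conn.preconnected (h : Conn G univ) : G.Preconnected := by
  intro u v
  let B : Finset V := {x | G.Reachable u x}
  by_contra huv
  obtain ⟨x, hx, y, -, hyB, hxy⟩ := h B (subset_univ _) ⟨u, by simp [B]⟩ (fun e => huv (by
    have : v ∈ B := e ▸ mem_univ v
    simpa [B] using this))
  simp only [B, mem_filter, mem_univ, true_and] at hx hyB
  exact hyB (hx.trans hxy.reachable)

theorem cycleGraph_adj_val {n : ℕ} (i j : Fin n) :
    (SimpleGraph.cycleGraph n).Adj i j ↔ i ≠ j ∧ (i.val + 1 = j.val ∨ j.val + 1 = i.val ∨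
      (i.val + 1 = n ∧ j.val = 0) ∨ (j.val + 1 = n ∧ i.val = 0)) := by
  rw [SimpleGraph.cycleGraph_adj', Fin.sub_def, Fin.sub_def, Ne, Fin.ext_iff]
  have hi := i.isLt
  have hj := j.isLt
  dsimp only
  have key : ∀ a b : ℕ, a < b → b < n →
      (n - b + a) % n = n - (b - a) ∧ (n - a + b) % n = b - a := by
    intro a b hab hb
    constructor
    · rw [Nat.mod_eq_of_lt (by omega)]
      omega
    · rw [show n - a + b = (b - a) + n by omega, Nat.add_mod_right, Nat.mod_eq_of_lt (by omega)]
  rcases lt_trichotomy i.val j.val with h | h | h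
  · rw [(key _ _ h hj).1, (key _ _ h hj).2]
    omega
  · rw [h, show n - j.val + j.val = n by omega, Nat.mod_self]
    omega
  · rw [(key _ _ h hi).1, (key _ _ h hi).2]
    omega

/-- A connected `2`-regular finite graph is a cycle. -/
theorem exists_iso_cycleGraph (hG : Conn G univ) (h2 : ∀ v, degIn G univ v = 2)
    [Nontrivial V] : ∃ n, 3 ≤ n ∧ Nonempty (SimpleGraph.cycleGraph n ≃g G) := by
  -- A nontrivial tree would have a leaf. The copy of a cycle found instead already uses both
  -- neighbours of each of its vertices, so by connectedness it is spanning, and it is induced.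
  have hnot : ¬ G.IsAcyclic := by
    intro hac
    obtain ⟨v, hv⟩ := SimpleGraph.IsTree.exists_vert_degree_one_of_nontrivial
      (G := G) ⟨⟨hG.preconnected⟩, hac⟩
    have := h2 v
    rw [degIn_univ] at this
    omega
  rw [SimpleGraph.isAcyclic_iff_free_cycleGraph] at hnot
  push Not at hnot
  obtain ⟨n, hn, hcon⟩ := hnot
  obtain ⟨⟨φ, hφ⟩⟩ := hcon
  obtain ⟨m, rfl⟩ : ∃ m, n = m + 3 := ⟨n - 3, by omega⟩
  refine ⟨m + 3, hn, ?_⟩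
  have hnbr : ∀ i, ∀ v, G.Adj (φ i) v → ∃ j, (SimpleGraph.cycleGraph (m + 3)).Adj i j ∧ φ j = v := by
    intro i v hv
    have hsub : ((SimpleGraph.cycleGraph (m + 3)).neighborFinset i).map ⟨φ, hφ⟩ ⊆
        G.neighborFinset (φ i) := by
      intro x hx
      obtain ⟨j, hj, rfl⟩ := mem_map.1 hx
      rw [SimpleGraph.mem_neighborFinset] at hj ⊢
      exact φ.map_adj hj
    have heq := eq_of_subset_of_card_le hsub (by
      rw [card_map, SimpleGraph.card_neighborFinset_eq_degree,
        SimpleGraph.card_neighborFinset_eq_degree, ← degIn_univ, h2,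
        SimpleGraph.cycleGraph_degree_three_le])
    have hv' : v ∈ G.neighborFinset (φ i) := (SimpleGraph.mem_neighborFinset ..).2 hv
    rw [← heq] at hv'
    obtain ⟨j, hj, rfl⟩ := mem_map.1 hv'
    exact ⟨j, (SimpleGraph.mem_neighborFinset ..).1 hj, rfl⟩
  have hsurj : Function.Surjective φ := by
    intro v
    by_contra hv
    obtain ⟨x, hx, y, -, hy, hxy⟩ := hG (univ.image φ) (subset_univ _) ⟨φ 0, by simp⟩
      (fun e => hv (by
        have : v ∈ univ.image φ := e ▸ mem_univ v
        simpa using this))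
    obtain ⟨i, -, rfl⟩ := mem_image.1 hx
    obtain ⟨j, -, rfl⟩ := hnbr i y hxy
    exact hy (mem_image_of_mem _ (mem_univ j))
  refine ⟨⟨Equiv.ofBijective φ ⟨hφ, hsurj⟩, ?_⟩⟩
  intro i j
  constructor
  · intro h
    obtain ⟨k, hk, hkj⟩ := hnbr i _ h
    rwa [hφ hkj] at hk
  · exact fun h => φ.map_adj h

namespace ValuedCover

variable {C : ValuedCover G κ}

/-- With a single kernel vertex in each fibre, projection to the base is bijective, and
`Critical.exists_adj` lifts every base edge. -/
theorem Critical.isMonoblock [NeZero κ] (h : C.Critical C.val univ) (hG : NoCut G univ)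
    (hcard : 2 ≤ Fintype.card V) (h2 : ¬ TwoColoured C.val univ) : C.IsMonoblock := by
  choose col hcol using fun v => h.exists_pos hcard (mem_univ v)
  have huniq : ∀ v q, 0 < C.val (v, q) → q = col v := by
    intro v q hq
    by_contra hne
    exact h2 ⟨v, mem_univ v, q, col v, hne, hq, hcol v⟩
  refine ⟨⟨⟨fun x => x.1.1, fun v => ⟨(v, col v), (hcol v).ne'⟩, ?_, fun v => rfl⟩, ?_⟩⟩
  · rintro ⟨⟨v, q⟩, hq⟩
    exact Subtype.ext (Prod.ext rfl (huniq v q (Nat.pos_of_ne_zero hq)).symm)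
  · rintro ⟨⟨v, p⟩, hp⟩ ⟨⟨u, q⟩, hq⟩
    constructor
    · intro huv
      obtain ⟨q', hadj, hq'⟩ := h.exists_adj (mem_univ v) (mem_univ u) (hG.erase v (mem_univ v))
        huv (Nat.pos_of_ne_zero hp)
      have : q' = q := (huniq u q' hq').trans (huniq u q (Nat.pos_of_ne_zero hq)).symm
      subst this
      exact hadj
    · intro hadj
      exact C.adj_fst _ _ hadj

/-- Each kernel vertex `r` over a base point `v₀` is transported along the matchings to all fibres.
The triangle property makes the transported vertices pairwise adjacent, so they form a copy of the
complete graph, and these copies exhaust the kernel. -/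
theorem Critical.isCompleteType [NeZero κ] (h : C.Critical C.val univ) (hG : NoCut G univ)
    (hcard : 2 ≤ Fintype.card V) (hcomp : ∀ u v, u ≠ v → G.Adj u v) : C.IsCompleteType := by
  obtain ⟨v₀⟩ : Nonempty V := Fintype.card_pos_iff.1 (by omega)
  let K := {r : Fin κ // 0 < C.val (v₀, r)}
  have hlift : ∀ v : V, ∀ r : K, ∃ q, 0 < C.val (v, q) ∧
      (v = v₀ ∧ q = r ∨ C.graph.Adj (v₀, r) (v, q)) := by
    intro v r
    by_cases hv : v = v₀
    · subst hv
      exact ⟨r, r.2, Or.inl ⟨rfl, rfl⟩⟩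
    · obtain ⟨q, hq, hpos⟩ := h.exists_adj (mem_univ v₀) (mem_univ v)
        (hG.erase v₀ (mem_univ v₀)) (hcomp _ _ (Ne.symm hv)) r.2
      exact ⟨q, hpos, Or.inr hq⟩
  choose L hLpos hL using hlift
  have hL₀ : ∀ r, L v₀ r = r := by
    intro r
    rcases hL v₀ r with h | h
    · exact h.2
    · exact absurd h (not_adj_fibre _ _ _)
  have hLadj : ∀ v r, v ≠ v₀ → C.graph.Adj (v₀, r.1) (v, L v r) := fun v r hv =>
    (hL v r).resolve_left fun h => hv h.1
  have hinj : ∀ v, Function.Injective (L v) := by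
    intro v r s hrs
    by_cases hv : v = v₀
    · subst hv
      rw [hL₀, hL₀] at hrs
      exact Subtype.ext hrs
    · have h1 := hLadj v r hv
      rw [hrs] at h1
      exact Subtype.ext (snd_eq_of_adj h1.symm (hLadj v s hv).symm)
  have hsurj : ∀ v q, 0 < C.val (v, q) → ∃ r, L v r = q := by
    intro v q hq
    by_cases hv : v = v₀
    · subst hv
      exact ⟨⟨q, hq⟩, hL₀ _⟩
    · obtain ⟨r, hr, hpos⟩ := h.exists_adj (mem_univ v) (mem_univ v₀)
        (hG.erase v (mem_univ v)) (hcomp _ _ hv) hq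
      exact ⟨⟨r, hpos⟩, snd_eq_of_adj (hLadj v ⟨r, hpos⟩ hv) hr.symm⟩
  have hadj : ∀ v u r, v ≠ u → C.graph.Adj (v, L v r) (u, L u r) := by
    intro v u r hvu
    by_cases hv : v = v₀
    · subst hv
      rw [hL₀]
      exact hLadj u r hvu.symm
    by_cases hu : u = v₀
    · subst hu
      rw [hL₀]
      exact (hLadj v r hv).symm
    · exact h.adj_of_triangle hG (mem_univ u) (mem_univ v₀) (mem_univ v) (hcomp _ _ hu)
        (hcomp _ _ hvu.symm) (hLadj v r hv).symm (hLadj u r hu) (hLpos v r)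
  let e : V ≃ Fin (Fintype.card V) := Fintype.equivFin V
  let e' : K ≃ Fin (Fintype.card K) := Fintype.equivFin K
  let F : Fin (Fintype.card V) × Fin (Fintype.card K) → C.kernelVerts := fun x =>
    ⟨(e.symm x.1, L (e.symm x.1) (e'.symm x.2)), (hLpos _ _).ne'⟩
  have hF : Function.Bijective F := by
    constructor
    · rintro ⟨i, j⟩ ⟨i', j'⟩ heq
      obtain ⟨h1, h2⟩ := Prod.ext_iff.1 (congrArg Subtype.val heq)
      have h1 : i = i' := e.symm.injective h1
      subst h1
      have h2 : j = j' := e'.symm.injective (hinj _ h2)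
      rw [h2]
    · rintro ⟨⟨v, q⟩, hq⟩
      obtain ⟨r, hr⟩ := hsurj v q (Nat.pos_of_ne_zero hq)
      refine ⟨(e v, e' r), ?_⟩
      simp only [F, Equiv.symm_apply_apply, hr]
  refine ⟨Fintype.card V, Fintype.card K, hcard, ⟨⟨e, ?_⟩⟩, ⟨SimpleGraph.Iso.symm
    ⟨Equiv.ofBijective F hF, ?_⟩⟩, ?_⟩
  · intro u v
    simp only [SimpleGraph.top_adj, ne_eq, EmbeddingLike.apply_eq_iff_eq]
    exact ⟨hcomp u v, fun h => h.ne⟩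
  · rintro ⟨i, j⟩ ⟨i', j'⟩
    change C.graph.Adj (e.symm i, L (e.symm i) (e'.symm j))
      (e.symm i', L (e.symm i') (e'.symm j')) ↔ (i ≠ i' ∧ j = j') ∨ (False ∧ i = i')
    simp only [false_and, or_false]
    constructor
    · intro hF
      have hne : e.symm i ≠ e.symm i' := (C.adj_fst _ _ hF).ne
      refine ⟨fun hi => hne (by rw [hi]), e'.symm.injective (hinj (e.symm i') ?_)⟩
      exact snd_eq_of_adj (hadj _ _ _ hne) hF
    · rintro ⟨hne, rfl⟩
      exact hadj _ _ _ (fun hi => hne (e.symm.injective hi))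
  · rintro x y ⟨p⟩
    induction p with
    | nil => rfl
    | @cons x y z hxy _ ih =>
      rw [← ih]
      exact h.eq_of_adj_of_complete hG (fun u _ v _ => hcomp u v) (mem_univ _) (mem_univ _) hxy
        (Nat.pos_of_ne_zero x.2)

end ValuedCover

end Building

/-! ### Double covers of cycles -/

section Cycle

variable {V : Type u} {G : SimpleGraph V} {κ : ℕ}

namespace ValuedCover

variable {C : ValuedCover G κ}

/-- The parity of a natural number. -/
def parity (i : ℕ) : Fin 2 := ⟨i % 2, Nat.mod_lt _ two_pos⟩

/-- `x 0, …, x (n - 1)` is a cyclic enumeration of the vertices, continued with period `n`, and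
`L i 0, L i 1` are the two colours of the kernel over `x i`, continued along the matchings. -/
structure IsLift (C : ValuedCover G κ) (n : ℕ) (x : ℕ → V) (L : ℕ → Fin 2 → Fin κ) : Prop where
  three_le : 3 ≤ n
  inj : ∀ i < n, ∀ j < n, x i = x j → i = j
  surj : ∀ v, ∃ i < n, x i = v
  period : x n = x 0
  base : ∀ i < n, ∀ j < n, G.Adj (x i) (x j) →
    i + 1 = j ∨ j + 1 = i ∨ (i + 1 = n ∧ j = 0) ∨ (j + 1 = n ∧ i = 0)
  val : ∀ i j, C.val (x i, L i j) = 1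
  ne : ∀ i, L i 0 ≠ L i 1
  mem : ∀ i q, C.val (x i, q) ≠ 0 → ∃ j, L i j = q
  adj : ∀ i j, C.graph.Adj (x i, L i j) (x (i + 1), L (i + 1) j)

theorem IsLift.injective {n : ℕ} {x : ℕ → V} {L : ℕ → Fin 2 → Fin κ} (h : C.IsLift n x L) (i : ℕ) :
    Function.Injective (L i) := by
  intro j k hjk
  have := h.ne i
  fin_cases j <;> fin_cases k
  · rfl
  · exact absurd hjk this
  · exact absurd hjk.symm this
  · rfl

/-- Adjacency is that of two parallel paths except across the closing edge: there `x n = x 0`, but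
the continued colours `L n` may be `L 0` in swapped order. -/
theorem IsLift.adj_iff {n : ℕ} {x : ℕ → V} {L : ℕ → Fin 2 → Fin κ} (h : C.IsLift n x L) {i i' : ℕ}
    (hi : i < n) (hi' : i' < n) (j j' : Fin 2) :
    C.graph.Adj (x i, L i j) (x i', L i' j') ↔
      (i + 1 = i' ∧ j = j') ∨ (i' + 1 = i ∧ j = j') ∨ (i + 1 = n ∧ i' = 0 ∧ L n j = L 0 j') ∨
        (i' + 1 = n ∧ i = 0 ∧ L n j' = L 0 j) := by
  have last : ∀ i j j', i + 1 = n →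
      (C.graph.Adj (x i, L i j) (x 0, L 0 j') ↔ L n j = L 0 j') := by
    rintro i j j' rfl
    have hadj := h.adj i j
    rw [h.period] at hadj
    constructor
    · exact fun h' => snd_eq_of_adj hadj h'
    · intro h'
      rwa [h'] at hadj
  have next : ∀ i j j', C.graph.Adj (x i, L i j) (x (i + 1), L (i + 1) j') → j = j' :=
    fun i j j' h' => h.injective _ (snd_eq_of_adj (h.adj i j) h')
  constructor
  · intro hadj
    rcases h.base i hi i' hi' (C.adj_fst _ _ hadj) with h' | h' | h' | h'
    · subst h'
      exact Or.inl ⟨rfl, next _ _ _ hadj⟩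
    · subst h'
      exact Or.inr (Or.inl ⟨rfl, (next _ _ _ hadj.symm).symm⟩)
    · obtain ⟨h1, rfl⟩ := h'
      exact Or.inr (Or.inr (Or.inl ⟨h1, rfl, (last _ _ _ h1).1 hadj⟩))
    · obtain ⟨h1, rfl⟩ := h'
      exact Or.inr (Or.inr (Or.inr ⟨h1, rfl, (last _ _ _ h1).1 hadj.symm⟩))
  · rintro (⟨rfl, rfl⟩ | ⟨rfl, rfl⟩ | ⟨h1, rfl, h2⟩ | ⟨h1, rfl, h2⟩)
    · exact h.adj _ _
    · exact (h.adj _ _).symm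
    · exact (last _ _ _ h1).2 h2
    · exact ((last _ _ _ h1).2 h2).symm

/-- The vertices of the kernel, enumerated by a lift. -/
theorem IsLift.exists_equiv {n : ℕ} {x : ℕ → V} {L : ℕ → Fin 2 → Fin κ} (h : C.IsLift n x L) :
    ∃ e : Fin n × Fin 2 ≃ C.kernelVerts, ∀ y, (e y).1 = (x y.1, L y.1 y.2) := by
  let F : Fin n × Fin 2 → C.kernelVerts := fun y =>
    ⟨(x y.1, L y.1 y.2), by simp [kernelVerts, h.val]⟩
  refine ⟨Equiv.ofBijective F ⟨?_, ?_⟩, fun y => rfl⟩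
  · rintro ⟨i, j⟩ ⟨i', j'⟩ heq
    obtain ⟨h1, h2⟩ := Prod.ext_iff.1 (congrArg Subtype.val heq)
    have h1 : i = i' := Fin.ext (h.inj _ i.2 _ i'.2 h1)
    subst h1
    have h2 : j = j' := h.injective _ h2
    rw [h2]
  · rintro ⟨⟨v, q⟩, hq⟩
    obtain ⟨i, hi, rfl⟩ := h.surj v
    obtain ⟨j, rfl⟩ := h.mem i q hq
    exact ⟨(⟨i, hi⟩, j), rfl⟩

/-- The alternating choice along a lift. -/
theorem IsLift.exists_degen [Fintype V] {n : ℕ} {x : ℕ → V} {L : ℕ → Fin 2 → Fin κ} (h : C.IsLift n x L)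
    (hpar : L n (parity (n - 1)) ≠ L 0 (parity 0)) : ∃ c, C.Degen C.val c univ := by
  choose idx hidx hx using h.surj
  refine ⟨fun v => L (idx v) (parity (idx v)), fun B _ ⟨v, hv⟩ => ⟨v, hv, ?_⟩⟩
  have hval : C.val (v, L (idx v) (parity (idx v))) = 1 := by
    have := h.val (idx v) (parity (idx v))
    rwa [hx] at this
  dsimp only
  rw [hval]
  -- All values are 1, so it suffices that the choice is independent; the hypothesis excludes the
  -- only possible edge, the closing one.
  suffices h0 : C.colDeg (fun v => L (idx v) (parity (idx v))) B v (L (idx v) (parity (idx v))) = 0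
    by omega
  unfold colDeg
  rw [card_eq_zero, filter_eq_empty_iff]
  intro u _ hadj
  have hadj' : C.graph.Adj (x (idx v), L (idx v) (parity (idx v)))
      (x (idx u), L (idx u) (parity (idx u))) := by
    rw [hx, hx]
    exact hadj
  rw [h.adj_iff (hidx v) (hidx u)] at hadj'
  have hsucc : ∀ i, parity i ≠ parity (i + 1) := by
    intro i hi
    have := Fin.ext_iff.1 hi
    simp only [parity] at this
    omega
  rcases hadj' with ⟨h1, h2⟩ | ⟨h1, h2⟩ | ⟨h1, h0, h2⟩ | ⟨h1, h0, h2⟩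
  · exact hsucc _ (h1 ▸ h2)
  · exact hsucc _ (h1 ▸ h2.symm)
  · rw [h0, show idx v = n - 1 by omega] at h2
    exact hpar h2
  · rw [h0, show idx u = n - 1 by omega] at h2
    exact hpar h2

/-- A critical cover of a cycle with two kernel vertices in a fibre has a lift. -/
theorem Critical.exists_isLift [Fintype V] [NeZero κ] (h : C.Critical C.val univ) (hG : NoCut G univ)
    {n : ℕ} (hn : 3 ≤ n) (e : SimpleGraph.cycleGraph n ≃g G) (hreg : ∀ v, degIn G univ v = 2)
    (h2 : TwoColoured C.val univ) : ∃ x L, C.IsLift n x L := by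
  have hall := fun v => h.forall_two_colours hG h2 v (mem_univ v)
  have hone : ∀ v q, C.val (v, q) ≤ 1 := by
    intro v q
    obtain ⟨p', q', hpq', hp', hq'⟩ := hall v
    exact le_one_of_sum_eq_two (g := fun q => C.val (v, q))
      ((h.sum_eq (mem_univ v)).trans (hreg v)) hpq' hp' hq' q
  -- The values in a fibre sum to the degree 2, so a third kernel colour does not fit.
  have hthird : ∀ v p q r, p ≠ q → 0 < C.val (v, p) → 0 < C.val (v, q) → C.val (v, r) ≠ 0 →
      r = p ∨ r = q := by
    intro v p q r hpq hp hq hr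
    by_contra hcon
    rw [not_or] at hcon
    have hs : ∑ z ∈ ({r, p, q} : Finset (Fin κ)), C.val (v, z) ≤ ∑ z, C.val (v, z) :=
      sum_le_sum_of_subset (subset_univ _)
    rw [sum_insert (by simp [hcon.1, hcon.2]), sum_pair hpq, h.sum_eq (mem_univ v), hreg] at hs
    omega
  have hmod : ∀ i, i % n < n := fun i => Nat.mod_lt _ (by omega)
  let x : ℕ → V := fun i => e ⟨i % n, hmod i⟩
  have hstep : ∀ i, G.Adj (x i) (x (i + 1)) := by
    intro i
    rw [SimpleGraph.Iso.map_adj_iff, cycleGraph_adj_val]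
    have h1 := hmod i
    have h3 : i % n + 1 < n ∧ (i + 1) % n = i % n + 1 ∨ i % n + 1 = n ∧ (i + 1) % n = 0 := by
      rw [Nat.add_mod, Nat.mod_eq_of_lt (by omega : 1 < n)]
      by_cases hlt : i % n + 1 < n
      · exact Or.inl ⟨hlt, Nat.mod_eq_of_lt hlt⟩
      · have : i % n + 1 = n := by omega
        exact Or.inr ⟨this, by rw [this, Nat.mod_self]⟩
    rw [Ne, Fin.ext_iff]
    dsimp only
    omega
  have hnext : ∀ i q, ∃ p, 0 < C.val (x i, q) →
      C.graph.Adj (x i, q) (x (i + 1), p) ∧ 0 < C.val (x (i + 1), p) := by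
    intro i q
    by_cases hq : 0 < C.val (x i, q)
    · obtain ⟨p, hp⟩ := h.exists_adj (mem_univ _) (mem_univ _) (hG.erase _ (mem_univ _)) (hstep i) hq
      exact ⟨p, fun _ => hp⟩
    · exact ⟨q, fun hq' => absurd hq' hq⟩
  choose nx hnx using hnext
  obtain ⟨p₀, q₀, hpq₀, hp₀, hq₀⟩ := hall (x 0)
  let L : ℕ → Fin 2 → Fin κ := fun i => Nat.rec (fun j => if j = 0 then p₀ else q₀)
    (fun i l j => nx i (l j)) i
  have hLpos : ∀ i j, 0 < C.val (x i, L i j) := by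
    intro i
    induction i with
    | zero =>
      intro j
      change 0 < C.val (x 0, if j = 0 then p₀ else q₀)
      split_ifs <;> assumption
    | succ i ih => exact fun j => (hnx i _ (ih j)).2
  have hLadj : ∀ i j, C.graph.Adj (x i, L i j) (x (i + 1), L (i + 1) j) :=
    fun i j => (hnx i _ (hLpos i j)).1
  have hLne : ∀ i, L i 0 ≠ L i 1 := by
    intro i
    induction i with
    | zero =>
      change (if (0 : Fin 2) = 0 then p₀ else q₀) ≠ if (1 : Fin 2) = 0 then p₀ else q₀
      simpa using hpq₀
    | succ i ih =>
      intro heq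
      have h1 := hLadj i 0
      rw [heq] at h1
      exact ih (snd_eq_of_adj h1.symm (hLadj i 1).symm)
  refine ⟨x, L, hn, ?_, ?_, ?_, ?_, ?_, hLne, ?_, hLadj⟩
  · intro i hi j hj hij
    have := Fin.ext_iff.1 (e.injective hij)
    simpa [Nat.mod_eq_of_lt hi, Nat.mod_eq_of_lt hj] using this
  · intro v
    refine ⟨(e.symm v).1, (e.symm v).2, ?_⟩
    have : (⟨(e.symm v).1 % n, hmod _⟩ : Fin n) = e.symm v :=
      Fin.ext (Nat.mod_eq_of_lt (e.symm v).2)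
    change e ⟨(e.symm v).1 % n, hmod _⟩ = v
    rw [this, RelIso.apply_symm_apply]
  · change e _ = e _
    congr 1
    exact Fin.ext (by simp)
  · intro i hi j hj hij
    rw [SimpleGraph.Iso.map_adj_iff, cycleGraph_adj_val] at hij
    simpa only [Nat.mod_eq_of_lt hi, Nat.mod_eq_of_lt hj] using hij.2
  · intro i j
    have h1 := hLpos i j
    have h2 := hone (x i) (L i j)
    omega
  · intro i q hq
    rcases hthird _ _ _ q (hLne i) (hLpos i 0) (hLpos i 1) hq with h' | h'
    · exact ⟨0, h'.symm⟩
    · exact ⟨1, h'.symm⟩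

/-- The alternating choice must fail at the closing edge. This makes the return map of the double
cover the identity for odd `n`, giving two disjoint cycles, and the swap for even `n`, giving the
Möbius ladder. -/
theorem Critical.isCycleType [Fintype V] [NeZero κ] (h : C.Critical C.val univ) (hG : NoCut G univ)
    (hcard : 2 ≤ Fintype.card V) (hreg : ∀ v, degIn G univ v = 2)
    (h2 : TwoColoured C.val univ) : C.IsOddCycleType ∨ C.IsEvenCycleType := by
  have : Nontrivial V := Fintype.one_lt_card_iff_nontrivial.1 (by omega)
  obtain ⟨n, hn, ⟨e⟩⟩ := exists_iso_cycleGraph hG.conn hreg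
  obtain ⟨x, L, hL⟩ := h.exists_isLift hG hn e hreg h2
  obtain ⟨F, hF⟩ := hL.exists_equiv
  have hpar : L n (parity (n - 1)) = L 0 (parity 0) := by
    by_contra hne
    obtain ⟨c, hc⟩ := hL.exists_degen hne
    exact h.bad c hc
  have hone : ∀ y ∈ C.kernelVerts, C.val y = 1 := by
    intro y hy
    have h1 := hF (F.symm ⟨y, hy⟩)
    rw [Equiv.apply_symm_apply] at h1
    change y = _ at h1
    rw [h1]
    exact hL.val _ _
  have hperiod : ∀ j, ∃ j', L 0 j' = L n j := by
    intro j
    refine hL.mem 0 _ ?_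
    rw [← hL.period, hL.val]
    exact one_ne_zero
  have hadj : ∀ y z, C.kernel.Adj (F y) (F z) ↔
      (y.1.val + 1 = z.1.val ∧ y.2 = z.2) ∨ (z.1.val + 1 = y.1.val ∧ y.2 = z.2) ∨
      (y.1.val + 1 = n ∧ z.1.val = 0 ∧ L n y.2 = L 0 z.2) ∨
        (z.1.val + 1 = n ∧ y.1.val = 0 ∧ L n z.2 = L 0 y.2) := by
    intro y z
    rw [← hL.adj_iff y.1.2 z.1.2, ← hF, ← hF]
    rfl
  -- The return map permutes two colours, so whether it fixes colour 0 determines it.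
  have hsame : ∀ j j', L n j = L 0 j' → (L n 0 = L 0 0 ↔ j = j') := by
    intro j j' hjj
    have i0 := hL.injective 0
    have hne := hL.ne n
    constructor
    · intro h0
      by_contra hcon
      fin_cases j <;> fin_cases j'
      · exact hcon rfl
      · exact hL.ne 0 (h0.symm.trans hjj)
      · exact hne (h0.trans hjj.symm)
      · exact hcon rfl
    · rintro rfl
      fin_cases j
      · exact hjj
      · obtain ⟨k, hk⟩ := hperiod 0
        fin_cases k
        · exact hk.symm
        · exact absurd (hk.symm.trans hjj.symm) hne
  have hiff : ∀ j j', L n j = L 0 j' ↔ (L n 0 = L 0 0 ↔ j = j') := by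
    intro j j'
    refine ⟨hsame j j', fun hj => ?_⟩
    obtain ⟨k, hk⟩ := hperiod j
    have h1 := hsame j k hk.symm
    rw [h1] at hj
    have : k = j' := by
      fin_cases j <;> fin_cases k <;> fin_cases j' <;> simp_all
    rw [← this, hk]
  by_cases h0 : L n 0 = L 0 0
  · left
    have hodd : Odd n := by
      have h1 := (hsame _ _ hpar).1 h0
      have := Fin.ext_iff.1 h1
      simp only [parity] at this
      rw [Nat.odd_iff]
      omega
    refine ⟨n, hn, hodd, ⟨e.symm⟩, ⟨SimpleGraph.Iso.symm ⟨F, ?_⟩⟩, hone⟩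
    intro y z
    have hiff' : ∀ j j', L n j = L 0 j' ↔ j = j' := fun j j' => by
      rw [hiff, iff_true_left h0]
    rw [hadj]
    change _ ↔ ((SimpleGraph.cycleGraph n).Adj y.1 z.1 ∧ y.2 = z.2) ∨ (False ∧ y.1 = z.1)
    rw [cycleGraph_adj_val, Ne, Fin.ext_iff (a := y.1), hiff', hiff', eq_comm (a := z.2)]
    simp only [false_and, or_false]
    have := y.1.2
    have := z.1.2
    constructor
    · rintro (h | h | h | h) <;> refine ⟨⟨?_, ?_⟩, ?_⟩ <;> omega
    · rintro ⟨⟨h1, h2 | h2 | h2 | h2⟩, h3⟩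
      · exact Or.inl ⟨h2, h3⟩
      · exact Or.inr (Or.inl ⟨h2, h3⟩)
      · exact Or.inr (Or.inr (Or.inl ⟨h2.1, h2.2, h3⟩))
      · exact Or.inr (Or.inr (Or.inr ⟨h2.1, h2.2, h3⟩))
  · right
    have heven : Even n := by
      have h1 := mt (hsame _ _ hpar).2 h0
      rw [Fin.ext_iff] at h1
      simp only [parity] at h1
      rw [Nat.even_iff]
      omega
    refine ⟨n, hn, heven, ⟨e.symm⟩, ⟨SimpleGraph.Iso.symm ⟨F, ?_⟩⟩, hone⟩
    intro y z
    have hiff' : ∀ j j', L n j = L 0 j' ↔ j ≠ j' := fun j j' => by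
      rw [hiff, iff_false_left h0]
    rw [hadj, hiff', hiff']
    simp only [mobiusLadder, SimpleGraph.fromRel_adj]
    have hne : y ≠ z ↔ ¬ (y.1.val = z.1.val ∧ y.2 = z.2) := by
      rw [Ne, Prod.ext_iff, Fin.ext_iff (a := y.1)]
    rw [hne, eq_comm (a := z.2) (b := y.2)]
    have := y.1.2
    have := z.1.2
    constructor
    · rintro (h | h | h | h)
      · exact ⟨by omega, Or.inl (Or.inl h)⟩
      · exact ⟨by omega, Or.inr (Or.inl h)⟩
      · exact ⟨by omega, Or.inl (Or.inr h)⟩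
      · exact ⟨by omega, Or.inr (Or.inr h)⟩
    · rintro ⟨-, (h | h) | (h | h)⟩
      · exact Or.inl h
      · exact Or.inr (Or.inr (Or.inl h))
      · exact Or.inr (Or.inl h)
      · exact Or.inr (Or.inr (Or.inr h))

end ValuedCover

end Cycle

/-! ### Critical covers are constructible -/

namespace ValuedCover

section Necessity

variable {V : Type u} [Fintype V] {G : SimpleGraph V} {κ : ℕ} {C : ValuedCover G κ}

theorem Critical.isBuilding [NeZero κ] (h : C.Critical C.val univ) (hG : NoCut G univ)
    (hcard : 2 ≤ Fintype.card V) : C.IsBuilding := by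
  refine ⟨fun v => by rw [vdeg_eq_degIn, h.sum_eq (mem_univ v)], ?_⟩
  by_cases h2 : TwoColoured C.val univ
  · right
    rcases hG.exists_reduction hcard with hcomp | hreg | ⟨S, v, a, d, hred⟩
    · exact Or.inl (h.isCompleteType hG hcard fun u v => hcomp u (mem_univ u) v (mem_univ v))
    · exact Or.inr (h.isCycleType hG hcard (fun v => hreg v (mem_univ v)) h2)
    · exact absurd hred ((h.eq_of_adj hG hcard h2).1 S v a d)
  · exact Or.inl (h.isMonoblock hG hcard h2)

end Necessity

/-- A critical cover of a graph with at least two vertices is constructible. -/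
theorem Critical.constructible {κ : ℕ} [NeZero κ] {V : Type u} [Fintype V] {G : SimpleGraph V}
    {C : ValuedCover G κ} (h : C.Critical C.val univ) (hcard : 2 ≤ Fintype.card V) :
    C.Constructible := by
  induction hn : Fintype.card V using Nat.strong_induction_on generalizing V with
  | _ n ih =>
  subst hn
  by_cases hG : NoCut G univ
  · exact .building C (h.isBuilding hG hcard)
  obtain ⟨w, hw⟩ : ∃ w, ¬ Conn G (univ.erase w) := by
    by_contra hcon
    push Not at hcon
    exact hG ⟨h.conn, fun v _ => hcon v⟩
  unfold Conn at hw
  push Not at hw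
  obtain ⟨B, hB, hne, hBne, hBsep⟩ := hw
  have hwB : w ∉ B := fun hwB => notMem_erase w univ (hB hwB)
  -- `B` is a union of components left by the cut vertex `w`. The two parts are `B` with `w` and the
  -- complement of `B`, which contains `w`.
  have hA : insert w B ∪ univ \ B = univ := by
    ext v
    simp only [mem_union, mem_insert, mem_sdiff, mem_univ, true_and, iff_true]
    tauto
  have hwI : insert w B ∩ (univ \ B) = {w} := by
    ext v
    simp only [mem_inter, mem_insert, mem_sdiff, mem_univ, true_and, mem_singleton]
    refine ⟨fun h => h.1.resolve_right h.2, ?_⟩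
    rintro rfl
    exact ⟨Or.inl rfl, hwB⟩
  have hsep : ∀ u ∈ insert w B, ∀ v ∈ univ \ B, u ≠ w → v ≠ w → ¬ G.Adj u v := by
    intro u hu v hv huw hvw
    exact hBsep u ((mem_insert.1 hu).resolve_left huw) v (mem_erase.2 ⟨hvw, mem_univ v⟩)
      (mem_sdiff.1 hv).2
  obtain ⟨z, hz⟩ : ∃ z, z ∉ insert w B := by
    by_contra hcon
    push Not at hcon
    refine hBne (Subset.antisymm hB fun z hz => ?_)
    exact (mem_insert.1 (hcon z)).resolve_left (mem_erase.1 hz).1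
  obtain ⟨b, hb⟩ := hne
  have hw₁ : w ∈ insert w B := mem_insert_self w B
  have hw₂ : w ∈ univ \ B := by simp [hwB]
  obtain ⟨g₁, g₂, hg, h₁, h₂⟩ := Critical.split (hA.symm ▸ h) hwI hsep
  refine .glue C _ _ _ _ _ _ (isGluing_restrict hA hwI hw₁ hw₂ hsep hg)
    (ih _ ?_ h₁.restrict ?_ rfl) (ih _ ?_ h₂.restrict ?_ rfl)
  · rw [Fintype.card_coe]
    exact card_lt_univ_of_notMem hz
  · rw [Fintype.card_coe]
    exact one_lt_card.2 ⟨w, hw₁, b, mem_insert_of_mem hb, fun e => hwB (e ▸ hb)⟩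
  · rw [Fintype.card_coe]
    exact card_lt_univ_of_notMem (x := b) (by simp [hb])
  · rw [Fintype.card_coe]
    rw [mem_insert, not_or] at hz
    exact one_lt_card.2 ⟨w, hw₂, z, by simp [hz.2], Ne.symm hz.1⟩

end ValuedCover

/-! ### Constructible covers have no strictly degenerate choice -/

namespace ValuedCover

section Sufficiency

variable {V : Type u} {G : SimpleGraph V} {κ : ℕ} {C : ValuedCover G κ}

/-- No choice of one vertex from each fibre is strictly degenerate. -/
def Obstructed (C : ValuedCover G κ) : Prop :=
  ∀ c : V → Fin κ, ∃ B : Finset V, B.Nonempty ∧ ∀ v ∈ B, C.val (v, c v) ≤ C.colDeg c B v (c v)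

theorem Obstructed.of_not_degen [Fintype V] (h : ∀ c, ¬ C.Degen C.val c univ) : C.Obstructed := by
  intro c
  have := h c
  unfold Degen at this
  push Not at this
  obtain ⟨B, -, hne, hB⟩ := this
  exact ⟨B, hne, hB⟩

theorem colDeg_map_le {V₁ : Type u} {G₁ : SimpleGraph V₁} {C₁ : ValuedCover G₁ κ} (i : V₁ ↪ V)
    (h : ∀ a p a' p', C₁.graph.Adj (a, p) (a', p') → C.graph.Adj (i a, p) (i a', p'))
    (c : V → Fin κ) (B : Finset V₁) (a : V₁) (q : Fin κ) :
    C₁.colDeg (fun a => c (i a)) B a q ≤ C.colDeg c (B.map i) (i a) q := by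
  unfold colDeg
  rw [filter_map, card_map]
  refine card_le_card fun u hu => ?_
  rw [mem_filter] at hu ⊢
  exact ⟨hu.1, h _ _ _ _ hu.2⟩

/-- If one of the two bad sets misses the glued vertex, its image is already bad. Otherwise the
union is bad, since at the glued vertex both the values and the disjointly counted degrees add. -/
theorem IsGluing.obstructed {V₁ V₂ : Type u} {G₁ : SimpleGraph V₁} {G₂ : SimpleGraph V₂}
    {C₁ : ValuedCover G₁ κ} {C₂ : ValuedCover G₂ κ} {i₁ : V₁ ↪ V} {i₂ : V₂ ↪ V} {w₁ : V₁}
    {w₂ : V₂} (h : C.IsGluing C₁ C₂ i₁ i₂ w₁ w₂) (h₁ : C₁.Obstructed) (h₂ : C₂.Obstructed) :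
    C.Obstructed := by
  intro c
  have hi₁ : ∀ a p a' p', C₁.graph.Adj (a, p) (a', p') → C.graph.Adj (i₁ a, p) (i₁ a', p') :=
    fun a p a' p' hadj => (h.cover_adj _ _ _ _).2 (Or.inl ⟨a, a', rfl, rfl, hadj⟩)
  have hi₂ : ∀ a p a' p', C₂.graph.Adj (a, p) (a', p') → C.graph.Adj (i₂ a, p) (i₂ a', p') :=
    fun a p a' p' hadj => (h.cover_adj _ _ _ _).2 (Or.inr ⟨a, a', rfl, rfl, hadj⟩)
  obtain ⟨B₁, hne₁, hB₁⟩ := h₁ fun a => c (i₁ a)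
  obtain ⟨B₂, hne₂, hB₂⟩ := h₂ fun a => c (i₂ a)
  have left : ∀ a ∈ B₁, a ≠ w₁ → C.val (i₁ a, c (i₁ a)) ≤ C.colDeg c (B₁.map i₁) (i₁ a) (c (i₁ a)) := by
    intro a ha haw
    rw [h.val_left a _ haw]
    exact (hB₁ a ha).trans (colDeg_map_le i₁ hi₁ c B₁ a _)
  have right : ∀ a ∈ B₂, a ≠ w₂ → C.val (i₂ a, c (i₂ a)) ≤ C.colDeg c (B₂.map i₂) (i₂ a) (c (i₂ a)) := by
    intro a ha haw
    rw [h.val_right a _ haw]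
    exact (hB₂ a ha).trans (colDeg_map_le i₂ hi₂ c B₂ a _)
  by_cases hw₁ : w₁ ∈ B₁
  swap
  · refine ⟨B₁.map i₁, hne₁.map, fun v hv => ?_⟩
    obtain ⟨a, ha, rfl⟩ := mem_map.1 hv
    exact left a ha fun e => hw₁ (e ▸ ha)
  by_cases hw₂ : w₂ ∈ B₂
  swap
  · refine ⟨B₂.map i₂, hne₂.map, fun v hv => ?_⟩
    obtain ⟨a, ha, rfl⟩ := mem_map.1 hv
    exact right a ha fun e => hw₂ (e ▸ ha)
  have hww : i₁ w₁ = i₂ w₂ := (h.overlap w₁ w₂).2 ⟨rfl, rfl⟩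
  have hcut : C.val (i₁ w₁, c (i₁ w₁)) ≤
      C.colDeg c (B₁.map i₁ ∪ B₂.map i₂) (i₁ w₁) (c (i₁ w₁)) := by
    have hdisj : Disjoint ((B₁.erase w₁).map i₁) ((B₂.erase w₂).map i₂) := by
      rw [disjoint_left]
      intro v hv hv'
      obtain ⟨a, ha, rfl⟩ := mem_map.1 hv
      obtain ⟨b, hb, hab⟩ := mem_map.1 hv'
      exact (mem_erase.1 ha).1 ((h.overlap a b).1 hab.symm).1
    have hsub : (B₁.erase w₁).map i₁ ∪ (B₂.erase w₂).map i₂ ⊆ B₁.map i₁ ∪ B₂.map i₂ :=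
      union_subset_union (map_subset_map.2 (erase_subset _ _)) (map_subset_map.2 (erase_subset _ _))
    have e := colDeg_mono (C := C) (c := c) hsub (i₁ w₁) (c (i₁ w₁))
    rw [colDeg_union hdisj] at e
    have e₁ := colDeg_map_le i₁ hi₁ c (B₁.erase w₁) w₁ (c (i₁ w₁))
    have e₂ := colDeg_map_le i₂ hi₂ c (B₂.erase w₂) w₂ (c (i₁ w₁))
    rw [colDeg_erase_self] at e₁ e₂
    have f₁ := hB₁ w₁ hw₁
    have f₂ := hB₂ w₂ hw₂
    rw [← hww] at e₂ f₂
    rw [h.val_glue]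
    omega
  refine ⟨B₁.map i₁ ∪ B₂.map i₂, (hne₁.map).mono subset_union_left, fun v hv => ?_⟩
  rcases mem_union.1 hv with hv | hv
  · obtain ⟨a, ha, rfl⟩ := mem_map.1 hv
    by_cases haw : a = w₁
    · subst haw
      exact hcut
    · exact (left a ha haw).trans (colDeg_mono subset_union_left _ _)
  · obtain ⟨a, ha, rfl⟩ := mem_map.1 hv
    by_cases haw : a = w₂
    · subst haw
      rw [← hww]
      exact hcut
    · exact (right a ha haw).trans (colDeg_mono subset_union_right _ _)

variable [Fintype V]

/-- Chosen vertices have positive value, so by cardinality they are the whole kernel, whose degree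
sum equals that of the base. Strict degeneracy would put one degree strictly below the base degree
while no other exceeds it. -/
theorem IsMonoblock.not_degen [Nonempty V] (h : C.IsMonoblock)
    (hsum : ∀ v, ∑ q, C.val (v, q) = degIn G univ v) (c : V → Fin κ) :
    ¬ C.Degen C.val c univ := by
  intro hc
  obtain ⟨φ⟩ := h
  have : Fintype C.kernelVerts := Fintype.ofFinite _
  let F : V → C.kernelVerts := fun v => ⟨(v, c v), (hc.pos (mem_univ v)).ne'⟩
  have hinj : Function.Injective F := fun u v huv =>
    (Prod.ext_iff.1 (congrArg Subtype.val huv)).1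
  have hbij : Function.Bijective F :=
    (Fintype.bijective_iff_injective_and_card F).2 ⟨hinj, (Fintype.card_congr φ.toEquiv).symm⟩
  have hle : ∀ v, C.kernel.degree (F v) ≤ C.colDeg c univ v (c v) := by
    intro v
    rw [← SimpleGraph.card_neighborFinset_eq_degree]
    unfold colDeg
    refine (card_le_card (t := image F {u ∈ univ | C.graph.Adj (v, c v) (u, c u)}) ?_).trans
      card_image_le
    intro y hy
    obtain ⟨u, rfl⟩ := hbij.2 y
    rw [SimpleGraph.mem_neighborFinset] at hy
    exact mem_image_of_mem _ (mem_filter.2 ⟨mem_univ u, hy⟩)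
  have htot : ∑ v, C.kernel.degree (F v) = ∑ v, degIn G univ v := by
    rw [Function.Bijective.sum_comp hbij fun x => C.kernel.degree x,
      ← Equiv.sum_comp φ.toEquiv fun v => degIn G univ v]
    refine sum_congr rfl fun x _ => ?_
    rw [degIn_univ]
    exact (φ.degree_eq x).symm
  obtain ⟨v, -, hlt⟩ := hc univ Subset.rfl univ_nonempty
  have hsum_lt : ∑ v, C.colDeg c univ v (c v) < ∑ v, degIn G univ v := by
    refine sum_lt_sum (fun u _ => ?_) ⟨v, mem_univ v, ?_⟩
    · exact (single_le_sum (f := fun q => C.colDeg c univ u q) (fun _ _ => Nat.zero_le _)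
        (mem_univ (c u))).trans (sum_colDeg_le C c univ u)
    · rw [← hsum]
      exact hlt.trans_le (single_le_sum (f := fun q => C.val (v, q)) (fun _ _ => Nat.zero_le _)
        (mem_univ (c v)))
  have := sum_le_sum fun v (_ : v ∈ (univ : Finset V)) => hle v
  omega

/-- Pigeonhole: the values of the copies of the complete graph sum to at most `p - 1`, and `p`
vertices are chosen. Some copy contains more chosen vertices than its value, and these form a clique
with no low vertex. -/
theorem IsCompleteType.not_degen (h : C.IsCompleteType)
    (hsum : ∀ v, ∑ q, C.val (v, q) = degIn G univ v) (c : V → Fin κ) :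
    ¬ C.Degen C.val c univ := by
  intro hc
  obtain ⟨p, k, hp, ⟨e⟩, ⟨φ⟩, hconst⟩ := h
  have hcard : Fintype.card V = p := by
    rw [Fintype.card_congr e.toEquiv, Fintype.card_fin]
  let i₀ : Fin p := ⟨0, by omega⟩
  let v₀ : V := e.symm i₀
  have hadj : ∀ x y, x ≠ y → (φ x).2 = (φ y).2 → C.kernel.Adj x y := by
    intro x y hxy h2
    rw [← φ.map_adj_iff]
    refine Or.inl ⟨fun h1 => hxy (φ.injective (Prod.ext h1 h2)), h2⟩
  let a : Fin k → ℕ := fun j => C.val (φ.symm (i₀, j)).1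
  have ha : ∀ x, C.val x.1 = a (φ x).2 := by
    intro x
    by_cases hx : x = φ.symm (i₀, (φ x).2)
    · exact congrArg (fun y : C.kernelVerts => C.val y.1) hx
    · exact hconst _ _ (hadj x _ hx (by rw [RelIso.apply_symm_apply])).reachable
  -- A copy has `p` vertices in distinct fibres, hence meets every fibre, in particular the one over
  -- `v₀`.
  have hfib : ∀ j, ∃ q, ∃ hq : C.val (v₀, q) ≠ 0, (φ ⟨(v₀, q), hq⟩).2 = j := by
    intro j
    let F : Fin p → V := fun i => (φ.symm (i, j)).1.1
    have hF : Function.Injective F := by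
      intro i i' hii
      by_contra hne
      have := hadj (φ.symm (i, j)) (φ.symm (i', j))
        (fun h => hne (congrArg Prod.fst (φ.symm.injective h)))
        (by rw [RelIso.apply_symm_apply, RelIso.apply_symm_apply])
      exact (C.adj_fst _ _ this).ne hii
    obtain ⟨i, hi⟩ := ((Fintype.bijective_iff_injective_and_card F).2
      ⟨hF, by rw [hcard, Fintype.card_fin]⟩).2 v₀
    have heq : (φ.symm (i, j)).1 = (v₀, (φ.symm (i, j)).1.2) := Prod.ext hi rfl
    refine ⟨(φ.symm (i, j)).1.2, heq ▸ (φ.symm (i, j)).2, ?_⟩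
    have : (⟨(v₀, (φ.symm (i, j)).1.2), heq ▸ (φ.symm (i, j)).2⟩ : C.kernelVerts) =
        φ.symm (i, j) := Subtype.ext heq.symm
    rw [this, RelIso.apply_symm_apply]
  choose col hcol hφcol using hfib
  have hcolinj : Function.Injective col := by
    intro j j' hjj
    have : (⟨(v₀, col j), hcol j⟩ : C.kernelVerts) = ⟨(v₀, col j'), hcol j'⟩ :=
      Subtype.ext (Prod.ext rfl hjj)
    exact (hφcol j).symm.trans ((congrArg (fun x => (φ x).2) this).trans (hφcol j'))
  have hasum : ∑ j, a j ≤ ∑ q, C.val (v₀, q) :=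
    calc ∑ j, a j = ∑ j, C.val (v₀, col j) :=
          sum_congr rfl fun j _ => by rw [ha ⟨_, hcol j⟩, hφcol]
      _ = ∑ q ∈ univ.map ⟨col, hcolinj⟩, C.val (v₀, q) := by rw [sum_map]; rfl
      _ ≤ _ := sum_le_sum_of_subset (subset_univ _)
  have hdeg : degIn G univ v₀ < p := by
    rw [degIn_univ, ← hcard]
    exact G.degree_lt_card_verts v₀
  rw [hsum] at hasum
  let tok : V → C.kernelVerts := fun v => ⟨(v, c v), (hc.pos (mem_univ v)).ne'⟩
  obtain ⟨j, -, hj⟩ : ∃ j ∈ (univ : Finset (Fin k)), a j < #{v ∈ (univ : Finset V) | (φ (tok v)).2 = j} := by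
    refine exists_lt_of_sum_lt ?_
    rw [← card_eq_sum_card_fiberwise (fun _ _ => mem_univ _), card_univ, hcard]
    omega
  obtain ⟨v, hv, hlt⟩ := hc _ (subset_univ {v ∈ (univ : Finset V) | (φ (tok v)).2 = j})
    (card_pos.1 (by omega))
  have hvj := (mem_filter.1 hv).2
  have hval : C.val (v, c v) = a j := by rw [← hvj]; exact ha (tok v)
  rw [hval] at hlt
  have hsub : ({v ∈ (univ : Finset V) | (φ (tok v)).2 = j} : Finset V).erase v ⊆
      {u ∈ ({v ∈ (univ : Finset V) | (φ (tok v)).2 = j} : Finset V) |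
        C.graph.Adj (v, c v) (u, c u)} := by
    intro u hu
    obtain ⟨huv, hu⟩ := mem_erase.1 hu
    refine mem_filter.2 ⟨hu, ?_⟩
    refine hadj (tok v) (tok u) (fun h => huv ?_) (hvj.trans (mem_filter.1 hu).2.symm)
    exact (congrArg (fun x : C.kernelVerts => x.1.1) h).symm
  have := card_le_card hsub
  rw [card_erase_of_mem hv] at this
  unfold colDeg at hlt
  omega

/-- If all values on the kernel are `1` and base and kernel are `2`-regular, then a strictly
degenerate choice is one side of a bipartition of the kernel. -/
theorem Degen.iff_not_of_adj {c : V → Fin κ} (hc : C.Degen C.val c univ)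
    (hsum : ∀ v, ∑ q, C.val (v, q) = 2) (hreg : ∀ v, degIn G univ v = 2)
    (hone : ∀ x ∈ C.kernelVerts, C.val x = 1)
    (hker : ∀ x, ∃ y z, y ≠ z ∧ C.kernel.Adj x y ∧ C.kernel.Adj x z)
    {x y : C.kernelVerts} (hxy : C.kernel.Adj x y) :
    x.1.2 = c x.1.1 ↔ ¬ y.1.2 = c y.1.1 := by
  -- With values 1, strict degeneracy tested on the two ends forbids any edge between chosen
  -- vertices.
  have hindep : ∀ u v, ¬ C.graph.Adj (u, c u) (v, c v) := by
    intro u v huv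
    obtain ⟨w, hw, hlt⟩ := hc {u, v} (subset_univ _) (insert_nonempty _ _)
    rw [hone _ (hc.pos (mem_univ w)).ne', Nat.lt_one_iff] at hlt
    unfold colDeg at hlt
    rw [card_eq_zero, filter_eq_empty_iff] at hlt
    rw [mem_insert, mem_singleton] at hw
    rcases hw with rfl | rfl
    · exact hlt (x := v) (by simp) huv
    · exact hlt (x := u) (by simp) huv.symm
  have hcover : ∀ x : C.kernelVerts, ∀ u, G.Adj x.1.1 u → ∃ q, C.val (u, q) ≠ 0 ∧
      C.graph.Adj x.1 (u, q) := by
    intro x u hxu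
    obtain ⟨y, z, hyz, hy, hz⟩ := hker x
    have hne : y.1.1 ≠ z.1.1 := fun h => hyz (Subtype.ext (C.matching _ _ _ hy hz h))
    have hsub : ({y.1.1, z.1.1} : Finset V) ⊆ {w ∈ (univ : Finset V) | G.Adj x.1.1 w} := by
      intro w hw
      rw [mem_insert, mem_singleton] at hw
      rcases hw with rfl | rfl
      · exact mem_filter.2 ⟨mem_univ _, C.adj_fst _ _ hy⟩
      · exact mem_filter.2 ⟨mem_univ _, C.adj_fst _ _ hz⟩
    have heq := eq_of_subset_of_card_le hsub (by
      rw [card_pair hne]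
      exact (hreg x.1.1).le)
    have hu : u ∈ ({y.1.1, z.1.1} : Finset V) := heq ▸ mem_filter.2 ⟨mem_univ u, hxu⟩
    rw [mem_insert, mem_singleton] at hu
    rcases hu with rfl | rfl
    · exact ⟨y.1.2, y.2, hy⟩
    · exact ⟨z.1.2, z.2, hz⟩
  obtain ⟨⟨v, p⟩, hp⟩ := x
  obtain ⟨⟨u, q⟩, hq⟩ := y
  change C.graph.Adj (v, p) (u, q) at hxy
  change p = c v ↔ ¬ q = c u
  constructor
  · rintro rfl rfl
    exact hindep _ _ hxy
  · intro hqu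
    by_contra hpv
    obtain ⟨q', hq', hadj⟩ := hcover ⟨(v, c v), (hc.pos (mem_univ v)).ne'⟩ u (C.adj_fst _ _ hxy)
    have h1 : q' ≠ c u := by
      rintro rfl
      exact hindep _ _ hadj
    have h2 : q ≠ q' := by
      rintro rfl
      exact hpv (snd_eq_of_adj hxy.symm hadj.symm)
    -- If neither end of the kernel edge were chosen, the fibre over `u` would contain three kernel
    -- vertices: the end `q`, the chosen one, and the neighbour `q'` of the chosen vertex over `v`.
    have hs : ∑ z ∈ ({q, q', c u} : Finset (Fin κ)), C.val (u, z) ≤ ∑ z, C.val (u, z) :=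
      sum_le_sum_of_subset (subset_univ _)
    rw [sum_insert (by simp [h2, hqu]), sum_pair h1, hsum] at hs
    have h3 := hc.pos (mem_univ u)
    have h4 := Nat.pos_of_ne_zero hq
    have h5 := Nat.pos_of_ne_zero hq'
    change 0 < C.val (u, q) at h4
    omega

theorem degIn_eq_two_of_iso {n : ℕ} (hn : 3 ≤ n) (e : G ≃g SimpleGraph.cycleGraph n) (v : V) :
    degIn G univ v = 2 := by
  obtain ⟨m, rfl⟩ : ∃ m, n = m + 3 := ⟨n - 3, by omega⟩
  rw [degIn_univ, ← e.degree_eq v]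
  convert SimpleGraph.cycleGraph_degree_three_le

theorem IsOddCycleType.not_degen (h : C.IsOddCycleType)
    (hsum : ∀ v, ∑ q, C.val (v, q) = degIn G univ v) (c : V → Fin κ) :
    ¬ C.Degen C.val c univ := by
  intro hc
  obtain ⟨n, hn, hodd, ⟨e⟩, ⟨φ⟩, hone⟩ := h
  have hreg := degIn_eq_two_of_iso hn e
  have hnbr : ∀ i : Fin n, ∃ j k, j ≠ k ∧ (SimpleGraph.cycleGraph n).Adj i j ∧
      (SimpleGraph.cycleGraph n).Adj i k := by
    obtain ⟨m, rfl⟩ : ∃ m, n = m + 3 := ⟨n - 3, by omega⟩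
    intro i
    have h1 : 1 < #((SimpleGraph.cycleGraph (m + 3)).neighborFinset i) := by
      rw [SimpleGraph.card_neighborFinset_eq_degree, SimpleGraph.cycleGraph_degree_three_le]
      omega
    obtain ⟨j, hj, k, hk, hjk⟩ := one_lt_card.1 h1
    rw [SimpleGraph.mem_neighborFinset] at hj hk
    exact ⟨j, k, hjk, hj, hk⟩
  have hker : ∀ x, ∃ y z, y ≠ z ∧ C.kernel.Adj x y ∧ C.kernel.Adj x z := by
    intro x
    obtain ⟨j, k, hjk, hj, hk⟩ := hnbr (φ x).1
    refine ⟨φ.symm (j, (φ x).2), φ.symm (k, (φ x).2), fun h => hjk ?_, ?_, ?_⟩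
    · exact congrArg Prod.fst (φ.symm.injective h)
    · rw [← φ.map_adj_iff, RelIso.apply_symm_apply]
      exact Or.inl ⟨hj, rfl⟩
    · rw [← φ.map_adj_iff, RelIso.apply_symm_apply]
      exact Or.inl ⟨hk, rfl⟩
  -- One component of the circular ladder is an odd cycle, and being chosen would 2-colour it.
  let s : Fin n → Bool := fun i => decide ((φ.symm (i, 0)).1.2 = c (φ.symm (i, 0)).1.1)
  have hs : ∀ {i j}, (SimpleGraph.cycleGraph n).Adj i j → s i ≠ s j := by
    intro i j hij
    have hadj : C.kernel.Adj (φ.symm (i, 0)) (φ.symm (j, 0)) :=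
      φ.symm.map_adj_iff.2 (Or.inl ⟨hij, rfl⟩)
    have := hc.iff_not_of_adj (fun v => (hsum v).trans (hreg v)) hreg hone hker hadj
    simp only [s, ne_eq, decide_eq_decide]
    tauto
  have hcol : (SimpleGraph.cycleGraph n).Colorable 2 := by
    have := (SimpleGraph.Coloring.mk s hs).colorable
    simpa using this
  have h1 := hcol.chromaticNumber_le
  rw [SimpleGraph.chromaticNumber_cycleGraph_of_odd n (by omega) hodd] at h1
  exact absurd h1 (by decide)

theorem IsEvenCycleType.not_degen (h : C.IsEvenCycleType)
    (hsum : ∀ v, ∑ q, C.val (v, q) = degIn G univ v) (c : V → Fin κ) :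
    ¬ C.Degen C.val c univ := by
  intro hc
  obtain ⟨n, hn, heven, ⟨e⟩, ⟨φ⟩, hone⟩ := h
  have hreg := degIn_eq_two_of_iso hn e
  rw [Nat.even_iff] at heven
  have hswap : ∀ j : Fin 2, j + 1 ≠ j := by decide
  have hsucc : ∀ (i : ℕ) (hi : i + 1 < n) (j : Fin 2),
      (mobiusLadder n).Adj (⟨i, by omega⟩, j) (⟨i + 1, hi⟩, j) := by
    intro i hi j
    rw [mobiusLadder, SimpleGraph.fromRel_adj]
    refine ⟨fun h => ?_, Or.inl (Or.inl ⟨rfl, rfl⟩)⟩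
    have := Fin.ext_iff.1 (Prod.ext_iff.1 h).1
    simp at this
  have hlast : ∀ j : Fin 2, (mobiusLadder n).Adj (⟨n - 1, by omega⟩, j) (⟨0, by omega⟩, j + 1) := by
    intro j
    rw [mobiusLadder, SimpleGraph.fromRel_adj]
    refine ⟨fun h => hswap j (Prod.ext_iff.1 h).2.symm,
      Or.inl (Or.inr ⟨?_, rfl, (hswap j).symm⟩)⟩
    dsimp only
    omega
  have htwice : ∀ j : Fin 2, j + 1 + 1 = j := by decide
  have hnbr : ∀ x, ∃ y z, y ≠ z ∧ (mobiusLadder n).Adj x y ∧ (mobiusLadder n).Adj x z := by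
    rintro ⟨⟨i, hi⟩, j⟩
    have hnext : ∃ y : Fin n × Fin 2, (y.1.val = i + 1 ∨ i + 1 = n ∧ y.1.val = 0) ∧
        (mobiusLadder n).Adj (⟨i, hi⟩, j) y := by
      by_cases h1 : i + 1 < n
      · exact ⟨_, Or.inl rfl, hsucc i h1 j⟩
      · obtain rfl : i = n - 1 := by omega
        exact ⟨_, Or.inr ⟨by omega, rfl⟩, hlast j⟩
    have hprev : ∃ y : Fin n × Fin 2, (y.1.val + 1 = i ∨ i = 0 ∧ y.1.val = n - 1) ∧
        (mobiusLadder n).Adj (⟨i, hi⟩, j) y := by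
      rcases i with _ | i
      · have := hlast (j + 1)
        rw [htwice] at this
        exact ⟨_, Or.inr ⟨rfl, rfl⟩, this.symm⟩
      · exact ⟨_, Or.inl rfl, (hsucc i hi j).symm⟩
    obtain ⟨y, hy, hxy⟩ := hnext
    obtain ⟨z, hz, hxz⟩ := hprev
    refine ⟨y, z, ?_, hxy, hxz⟩
    rintro rfl
    omega
  have hker : ∀ x, ∃ y z, y ≠ z ∧ C.kernel.Adj x y ∧ C.kernel.Adj x z := by
    intro x
    obtain ⟨y, z, hyz, hy, hz⟩ := hnbr (φ x)
    refine ⟨φ.symm y, φ.symm z, fun h => hyz (φ.symm.injective h), ?_, ?_⟩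
    · rwa [← φ.map_adj_iff, RelIso.apply_symm_apply]
    · rwa [← φ.map_adj_iff, RelIso.apply_symm_apply]
  let g : V → Prop := fun v => (e v).val % 2 = 0
  have hg : ∀ u v, G.Adj u v → (g u ↔ ¬ g v) := by
    intro u v huv
    rw [← e.map_adj_iff, cycleGraph_adj_val] at huv
    simp only [g]
    omega
  -- Both being chosen and the parity `g` of the base point flip along kernel edges, so their
  -- agreement `s` is invariant. The Möbius ladder is connected, hence `s` is constant; evaluated at
  -- chosen vertices it equals `g`, which is not constant.
  let s : Fin n × Fin 2 → Prop := fun y =>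
    ((φ.symm y).1.2 = c (φ.symm y).1.1 ↔ g (φ.symm y).1.1)
  have hs : ∀ {y z}, (mobiusLadder n).Adj y z → (s y ↔ s z) := by
    intro y z hyz
    have hadj : C.kernel.Adj (φ.symm y) (φ.symm z) := φ.symm.map_adj_iff.2 hyz
    have h1 := hc.iff_not_of_adj (fun v => (hsum v).trans (hreg v)) hreg hone hker hadj
    have h2 := hg _ _ (C.adj_fst _ _ hadj)
    simp only [s]
    tauto
  have hpath : ∀ (i : ℕ) (hi : i < n) (j : Fin 2), s (⟨i, hi⟩, j) ↔ s (⟨0, by omega⟩, j) := by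
    intro i
    induction i with
    | zero => exact fun _ _ => Iff.rfl
    | succ i ih => exact fun hi j => (hs (hsucc i hi j)).symm.trans (ih (by omega) j)
  have hcross : ∀ j : Fin 2, s (⟨0, by omega⟩, j) ↔ s (⟨0, by omega⟩, 0) := by
    intro j
    fin_cases j
    · exact Iff.rfl
    · exact ((hpath (n - 1) (by omega) 0).symm.trans (hs (hlast 0))).symm
  have hall : ∀ y, s y ↔ s (⟨0, by omega⟩, 0) := fun y => (hpath y.1.1 y.1.2 y.2).trans (hcross y.2)
  have htok : ∀ v, g v ↔ s (⟨0, by omega⟩, 0) := by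
    intro v
    have h1 := hall (φ ⟨(v, c v), (hc.pos (mem_univ v)).ne'⟩)
    simp only [s, RelIso.symm_apply_apply, true_iff] at h1
    exact h1
  have hedge : G.Adj (e.symm ⟨0, by omega⟩) (e.symm ⟨1, by omega⟩) := by
    rw [e.symm.map_adj_iff, cycleGraph_adj_val]
    exact ⟨by simp, Or.inl rfl⟩
  have h1 := hg _ _ hedge
  rw [htok, htok] at h1
  tauto

theorem IsBuilding.obstructed [Nonempty V] (h : C.IsBuilding) : C.Obstructed := by
  obtain ⟨hsum, h⟩ := h
  have hsum' : ∀ v, ∑ q, C.val (v, q) = degIn G univ v := fun v => by rw [hsum, vdeg_eq_degIn]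
  refine Obstructed.of_not_degen ?_
  rcases h with h | h | h | h
  · exact h.not_degen hsum'
  · exact h.not_degen hsum'
  · exact h.not_degen hsum'
  · exact h.not_degen hsum'

end Sufficiency

theorem Constructible.obstructed {κ : ℕ} {V : Type u} [Nonempty V] {G : SimpleGraph V}
    {C : ValuedCover G κ} (h : C.Constructible) : C.Obstructed := by
  -- Nonemptiness is carried through the induction because an empty base has no bad set; glued parts
  -- contain `w₁` and `w₂`.
  suffices hsuff : ∀ {V : Type u} {G : SimpleGraph V} {C : ValuedCover G κ}, C.Constructible →
      Nonempty V → C.Obstructed from hsuff h inferInstance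
  intro V G C h
  induction h with
  | building C h =>
    intro _
    have := Fintype.ofFinite
    exact h.obstructed
  | glue C C₁ C₂ i₁ i₂ w₁ w₂ h _ _ ih₁ ih₂ =>
    exact fun _ => h.obstructed (ih₁ ⟨w₁⟩) (ih₂ ⟨w₂⟩)

end ValuedCover

/-! ### Choices versus transversals, and the degree bound -/

namespace ValuedCover

section Transversals

variable {V : Type u} [Fintype V] {G : SimpleGraph V} {κ : ℕ} {C : ValuedCover G κ}

theorem sum_colDeg_eq (c : V → Fin κ) (v : V) :
    ∑ u, C.colDeg c univ u (c u) = 2 * C.colDeg c univ v (c v) +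
      ∑ u ∈ univ.erase v, C.colDeg c (univ.erase v) u (c u) := by
  have h1 : ∀ u, C.colDeg c univ u (c u) =
      (if C.graph.Adj (u, c u) (v, c v) then 1 else 0) + C.colDeg c (univ.erase v) u (c u) := by
    intro u
    rw [← colDeg_insert (notMem_erase v univ), insert_erase (mem_univ v)]
  have h2 : ∑ u ∈ univ.erase v, (if C.graph.Adj (u, c u) (v, c v) then 1 else 0) =
      C.colDeg c univ v (c v) := by
    rw [← colDeg_erase_self, sum_boole]
    unfold colDeg
    simp only [Nat.cast_id, C.graph.adj_comm]
  rw [← add_sum_erase univ _ (mem_univ v), sum_congr rfl fun u _ => h1 u, sum_add_distrib, h2]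
  ring

/-- Among all strictly degenerate choices one can find one with bounded degrees. -/
theorem exists_degen_colDeg_le (hf : ∀ v, degIn G univ v ≤ ∑ q, C.val (v, q))
    (h : ∃ c, C.Degen C.val c univ) :
    ∃ c, C.Degen C.val c univ ∧ ∀ v, C.colDeg c univ v (c v) ≤ C.val (v, c v) := by
  -- The degree sum counts each edge of `H[R]` twice, hence the factor 2 before the values.
  -- Recolouring `v` from `c v` to `q` changes half of `Φ` by the excess of degree over value at `q`
  -- minus that at `c v`, which is negative here.
  let Φ : (V → Fin κ) → ℤ := fun c =>
    (∑ u, C.colDeg c univ u (c u) : ℕ) - 2 * (∑ u, C.val (u, c u) : ℕ)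
  obtain ⟨c, hc, hmin⟩ := exists_min_image {c | C.Degen C.val c univ} Φ
    (by obtain ⟨c, hc⟩ := h; exact ⟨c, by simpa using hc⟩)
  have hc := (mem_filter.1 hc).2
  refine ⟨c, hc, fun v => ?_⟩
  by_contra hlt
  rw [not_le] at hlt
  obtain ⟨q, hq⟩ : ∃ q, C.colDeg c univ v q < C.val (v, q) := by
    by_contra hcon
    push Not at hcon
    have h1 : ∑ q, C.val (v, q) < ∑ q, C.colDeg c univ v q :=
      sum_lt_sum (fun q _ => hcon q) ⟨c v, mem_univ _, hlt⟩
    have h2 := sum_colDeg_le C c univ v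
    have h3 := hf v
    omega
  have hc' : C.Degen C.val (Function.update c v q) univ := by
    have := (hc.mono (erase_subset v univ)).insert_last (notMem_erase v univ)
      (by rwa [colDeg_erase_self] : C.colDeg c (univ.erase v) v q < C.val (v, q))
    rwa [insert_erase (mem_univ v)] at this
  have hΦ := hmin _ (mem_filter.2 ⟨mem_univ _, hc'⟩)
  have hoff : ∀ u ∈ univ.erase v, Function.update c v q u = c u := fun u hu =>
    Function.update_of_ne (mem_erase.1 hu).1 _ _
  have e₁ := sum_colDeg_eq (C := C) c v
  have e₂ := sum_colDeg_eq (C := C) (Function.update c v q) v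
  have e₅ : ∑ u ∈ univ.erase v, C.colDeg (Function.update c v q) (univ.erase v) u
      (Function.update c v q u) = ∑ u ∈ univ.erase v, C.colDeg c (univ.erase v) u (c u) :=
    sum_congr rfl fun u hu => by rw [hoff u hu, colDeg_congr hoff]
  rw [Function.update_self, ← colDeg_erase_self, colDeg_congr hoff, colDeg_erase_self, e₅] at e₂
  have e₃ := add_sum_erase univ (fun u => C.val (u, c u)) (mem_univ v)
  have e₄ := add_sum_erase univ (fun u => C.val (u, Function.update c v q u)) (mem_univ v)
  rw [Function.update_self, sum_congr rfl fun u hu => by rw [hoff u hu]] at e₄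
  simp only [Φ] at hΦ
  omega

theorem IsStrictlyDegenerateTransversal.exists_degen {R : Set (V × Fin κ)}
    (h : C.IsStrictlyDegenerateTransversal R) : ∃ c, C.Degen C.val c univ := by
  obtain ⟨hR, hdeg⟩ := h
  choose c hc huniq using hR
  refine ⟨c, fun B _ ⟨b, hb⟩ => ?_⟩
  let S : Set R := {x | x.1.1 ∈ B}
  obtain ⟨x, hx, hlt⟩ := hdeg ((⊤ : (C.graph.induce R).Subgraph).induce S) ⟨⟨(b, c b), hc b⟩, hb⟩
  have hxc : x.1 = (x.1.1, c x.1.1) := Prod.ext rfl (huniq _ _ x.2)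
  refine ⟨x.1.1, hx, ?_⟩
  rw [← hxc]
  refine lt_of_le_of_lt ?_ hlt
  unfold colDeg
  rw [← hxc, ← card_image_of_injective (f := fun u => (⟨(u, c u), hc u⟩ : R)) _
    (fun u v huv => congrArg (fun y : R => y.1.1) huv), ← Set.ncard_coe_finset]
  refine Set.ncard_le_ncard ?_ (Set.toFinite _)
  intro y hy
  obtain ⟨u, hu, rfl⟩ := mem_image.1 (mem_coe.1 hy)
  obtain ⟨huB, hadj⟩ := mem_filter.1 hu
  exact ⟨hx, huB, hadj⟩

theorem exists_transversal {c : V → Fin κ} (hc : C.Degen C.val c univ)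
    (hle : ∀ v, C.colDeg c univ v (c v) ≤ C.val (v, c v)) :
    ∃ R : Set (V × Fin κ), C.IsStrictlyDegenerateTransversal R ∧
      ∀ x : R, vdeg (C.graph.induce R) x ≤ C.val x := by
  let R : Set (V × Fin κ) := {x | x.2 = c x.1}
  let tok : V → R := fun v => ⟨(v, c v), rfl⟩
  have htok : ∀ x : R, tok x.1.1 = x := fun x => Subtype.ext (Prod.ext rfl x.2.symm)
  have hcard : ∀ (B : Finset V) (v : V) (N : Set R),
      (∀ u, tok u ∈ N → u ∈ B ∧ C.graph.Adj (v, c v) (u, c u)) →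
      N.ncard ≤ C.colDeg c B v (c v) := by
    intro B v N hN
    unfold colDeg
    refine le_trans ?_ (card_image_le (f := tok))
    rw [← Set.ncard_coe_finset]
    refine Set.ncard_le_ncard (fun y hy => ?_) (Set.toFinite _)
    rw [← htok y] at hy ⊢
    exact mem_coe.2 (mem_image_of_mem _ (mem_filter.2 (hN _ hy)))
  refine ⟨R, ⟨fun v => ⟨c v, rfl, fun q hq => hq⟩, fun Γ hΓ => ?_⟩, fun x => ?_⟩
  · obtain ⟨y, hy⟩ := hΓ
    obtain ⟨v, hv, hlt⟩ := hc {v | tok v ∈ Γ.verts} (subset_univ _)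
      ⟨y.1.1, by simpa [htok] using hy⟩
    refine ⟨tok v, (mem_filter.1 hv).2, lt_of_le_of_lt (hcard _ v _ fun u hu => ?_) hlt⟩
    exact ⟨mem_filter.2 ⟨mem_univ u, Γ.edge_vert hu.symm⟩, Γ.adj_sub hu⟩
  · rw [← htok x]
    exact (hcard univ x.1.1 _ fun u hu => ⟨mem_univ u, hu⟩).trans (hle x.1.1)

end Transversals

end ValuedCover

theorem conn_univ_of_connected {V : Type u} [Fintype V] {G : SimpleGraph V} (hG : G.Connected) :
    Conn G univ := by
  rintro B - ⟨u, hu⟩ hB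
  obtain ⟨v, hv⟩ : ∃ v, v ∉ B := by
    by_contra hcon
    push Not at hcon
    exact hB (eq_univ_of_forall hcon)
  obtain ⟨p⟩ := hG.preconnected u v
  obtain ⟨d, -, h1, h2⟩ := p.exists_boundary_dart (B : Set V) (mem_coe.2 hu)
    (fun h => hv (mem_coe.1 h))
  exact ⟨d.fst, mem_coe.1 h1, d.snd, mem_univ _, fun h => h2 (mem_coe.2 h), d.adj⟩

/-- A valued cover of a connected graph has a strictly degenerate transversal with bounded degrees
if and only if it is not constructible. -/
theorem ValuedCover.exists_transversal_iff {V : Type u} [Finite V] {G : SimpleGraph V}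
    (hG : G.Connected) {κ : ℕ} (C : ValuedCover G κ) (hpos : ∃ x, C.val x ≠ 0)
    (hdeg : ∀ v, vdeg G v ≤ ∑ q, C.val (v, q)) :
    (∃ R : Set (V × Fin κ), C.IsStrictlyDegenerateTransversal R ∧
        ∀ x : R, vdeg (C.graph.induce R) x ≤ C.val x) ↔ ¬ C.Constructible := by
  have := Fintype.ofFinite V
  have : Nonempty V := hG.nonempty
  have hf : ∀ v, degIn G univ v ≤ ∑ q, C.val (v, q) := fun v => by
    rw [← vdeg_eq_degIn]
    exact hdeg v
  constructor
  · rintro ⟨R, hR, -⟩ hC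
    obtain ⟨c, hc⟩ := hR.exists_degen
    obtain ⟨B, hne, hB⟩ := hC.obstructed c
    obtain ⟨v, hv, hlt⟩ := hc B (subset_univ B) hne
    exact absurd (hB v hv) (not_le.2 hlt)
  · intro hC
    obtain ⟨x, hx⟩ := hpos
    -- A vertex of nonzero value supplies a colour. The same vertex settles the one-vertex graph,
    -- which is not covered by the argument for critical sets.
    have : NeZero κ := ⟨fun h => (h ▸ x.2 : Fin 0).elim0⟩
    have hex : ∃ c, C.Degen C.val c univ := by
      by_contra hcon
      push Not at hcon
      by_cases hcard : 2 ≤ Fintype.card V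
      · exact hC (ValuedCover.Critical.constructible ⟨conn_univ_of_connected hG,
          fun v _ => hf v, hcon⟩ hcard)
      · have : Subsingleton V := Fintype.card_le_one_iff_subsingleton.1 (by omega)
        refine hcon (fun _ => x.2) ?_
        rw [eq_singleton_iff_unique_mem.2 ⟨mem_univ x.1, fun y _ => Subsingleton.elim y x.1⟩]
        exact ValuedCover.degen_singleton (Nat.pos_of_ne_zero hx)
    obtain ⟨c, hc, hle⟩ := ValuedCover.exists_degen_colDeg_le hf hex
    exact ValuedCover.exists_transversal hc hle

end

end CoverDegeneracy

theorem mainTheorem2 {V : Type u} [Finite V] (G : SimpleGraph V) (hG : G.Connected) (κ : ℕ)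
    (C : CoverDegeneracy.ValuedCover G κ)
    (hpos : ∃ x, C.val x ≠ 0)
    (hdeg : ∀ v, CoverDegeneracy.vdeg G v ≤ ∑ q, C.val (v, q)) :
    (∃ R : Set (V × Fin κ), C.IsStrictlyDegenerateTransversal R ∧
        ∀ x : R, CoverDegeneracy.vdeg (C.graph.induce R) x ≤ C.val x) ↔
      ¬ C.Constructible :=
  C.exists_transversal_iff hG hpos hdeg
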